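/- Let $m\ge 2$ and $r\ge 3$ be integers. An $r$-graph is a hypergraph all of whose edges have exactly $r$ vertices. Let $C^r_{2m+1}$ denote the $r$-uniform linear cycle of length $2m+1$, that is, the (up to isomorphism unique) $r$-graph without isolated vertices with edges $e_1,\dots,e_{2m+1}$ such that $|e_i\cap e_{i+1}|=1$ for $1\le i\le 2m$, $|e_{2m+1}\cap e_1|=1$, and $e_i\cap e_j=\emptyset$ for all other pairs $i\ne j$. Let $K^r_t$ denote the complete $r$-graph on $t$ vertices. For $r$-graphs $G$ and $H$, the Ramsey number $R(G,H)$ is the smallest positive integer $n$ such that every colouring of the edges of $K^r_n$ with the two colours red and blue contains a red copy of $G$ or a blue copy of $H$. Then there exists a constant $b_{m,r}>0$, depending only on $m$ and $r$, such that for every integer $t\ge 1$ the number $R(C^r_{2m+1},K^r_t)$ exists and $$R(C^r_{2m+1},K^r_t)\le b_{m,r}\,t^{\frac{m}{m-1}}.$$ -/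

import Mathlib

namespace CycleComplete

/-- A hypergraph is `r`-uniform (an `r`-graph) if all of its edges have exactly `r` elements. -/
def IsUniform {α : Type*} (r : ℕ) (G : Hypergraph α) : Prop :=
  ∀ e ∈ G.edgeSet, e.encard = (r : ℕ∞)

/-- `K^r_n`: the complete `r`-graph on the `n` vertices `Fin n`. -/
def completeUniform (r n : ℕ) : Hypergraph (Fin n) where
  vertexSet := Set.univ
  edgeSet := {e | e.ncard = r}
  subset_vertexSet_of_mem_edgeSet' := fun _ _ => Set.subset_univ _

/-- The `i`-th edge of the `r`-uniform linear cycle of length `ℓ`: the consecutive skeleton vertices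
`i` and `i + 1` together with `r - 2` expansion vertices that belong to this edge only. -/
def linearCycleEdge (r ℓ : ℕ) (i : ZMod ℓ) : Set (ZMod ℓ ⊕ ZMod ℓ × Fin (r - 2)) :=
  {Sum.inl i, Sum.inl (i + 1)} ∪ Set.range fun j : Fin (r - 2) => Sum.inr (i, j)

/-- `C^r_ℓ` (for `r ≥ 2`, `ℓ ≥ 3`): the `r`-uniform linear cycle of length `ℓ`, realised as the
`r`-expansion of the graph cycle on `ZMod ℓ`. -/
def linearCycle (r ℓ : ℕ) : Hypergraph (ZMod ℓ ⊕ ZMod ℓ × Fin (r - 2)) where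
  vertexSet := Set.univ
  edgeSet := Set.range (linearCycleEdge r ℓ)
  subset_vertexSet_of_mem_edgeSet' := fun _ _ => Set.subset_univ _

/-- `H` contains a copy of `G`: an injection of the vertices of `G` into the vertices of `H` maps
every edge of `G` to an edge of `H`. -/
def ContainsCopy {α β : Type*} (H : Hypergraph β) (G : Hypergraph α) : Prop :=
  ∃ f : α → β, Set.InjOn f G.vertexSet ∧ Set.MapsTo f G.vertexSet H.vertexSet ∧
    ∀ e ∈ G.edgeSet, f '' e ∈ H.edgeSet

/-- The two colours. -/
inductive Colour
  | red
  | blue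

/-- The `r`-graph on `Fin n` formed by the edges of `K^r_n` that the colouring `c` gives the
colour `k`. -/
def colourClass {r n : ℕ} (c : (completeUniform r n).edgeSet → Colour) (k : Colour) :
    Hypergraph (Fin n) where
  vertexSet := Set.univ
  edgeSet := {e | ∃ h : e ∈ (completeUniform r n).edgeSet, c ⟨e, h⟩ = k}
  subset_vertexSet_of_mem_edgeSet' := fun _ _ => Set.subset_univ _

/-- Every red/blue colouring of the edges of `K^r_n` has a red copy of `G` or a blue copy of `H`. -/
def Arrows {α β : Type*} (r : ℕ) (G : Hypergraph α) (H : Hypergraph β) (n : ℕ) : Prop :=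
  ∀ c : (completeUniform r n).edgeSet → Colour,
    ContainsCopy (colourClass c Colour.red) G ∨ ContainsCopy (colourClass c Colour.blue) H

/-- `R` is the Ramsey number `R(G, H)` of the `r`-graphs `G` and `H`: the smallest positive integer
`n` such that every red/blue colouring of `K^r_n` has a red copy of `G` or a blue copy of `H`. -/
def IsRamseyNumber {α β : Type*} (r : ℕ) (G : Hypergraph α) (H : Hypergraph β) (R : ℕ) : Prop :=
  IsLeast {n : ℕ | 0 < n ∧ Arrows r G H n} R

theorem completeUniform_isUniform (r n : ℕ) : IsUniform r (completeUniform r n) := by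
  intro e he
  have h : e.ncard = r := he
  rw [← h, (Set.toFinite e).cast_ncard_eq]

theorem mem_linearCycleEdge_inl {r ℓ : ℕ} (i x : ZMod ℓ) :
    (Sum.inl x : ZMod ℓ ⊕ ZMod ℓ × Fin (r - 2)) ∈ linearCycleEdge r ℓ i ↔ x = i ∨ x = i + 1 := by
  simp [linearCycleEdge]

theorem mem_linearCycleEdge_inr {r ℓ : ℕ} (i : ZMod ℓ) (p : ZMod ℓ × Fin (r - 2)) :
    (Sum.inr p : ZMod ℓ ⊕ ZMod ℓ × Fin (r - 2)) ∈ linearCycleEdge r ℓ i ↔ p.1 = i := by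
  obtain ⟨x, j⟩ := p
  simp [linearCycleEdge, eq_comm]

/-- `C^r_ℓ` is an `r`-graph. -/
theorem linearCycle_isUniform {r ℓ : ℕ} (hr : 2 ≤ r) (hl : 3 ≤ ℓ) :
    IsUniform r (linearCycle r ℓ) := by
  rintro _ ⟨i, rfl⟩
  have : Fact (1 < ℓ) := ⟨by omega⟩
  have hd : Disjoint ({Sum.inl i, Sum.inl (i + 1)} : Set (ZMod ℓ ⊕ ZMod ℓ × Fin (r - 2)))
      (Set.range fun j : Fin (r - 2) => Sum.inr (i, j)) := by
    rw [Set.disjoint_left]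
    rintro x (rfl | rfl) ⟨j, hj⟩ <;> cases hj
  have hinj : Function.Injective
      (fun j : Fin (r - 2) => (Sum.inr (i, j) : ZMod ℓ ⊕ ZMod ℓ × Fin (r - 2))) := by
    intro a b h
    simpa using h
  rw [linearCycleEdge, Set.encard_union_eq hd, Set.encard_pair (by simp), ← Set.image_univ,
    hinj.encard_image, Set.encard_univ, ENat.card_eq_coe_fintype_card, Fintype.card_fin]
  norm_cast
  omega

/-- Consecutive edges of `C^r_ℓ` (cyclically) meet in exactly one vertex. -/
theorem linearCycleEdge_inter_succ {r ℓ : ℕ} (hl : 3 ≤ ℓ) (i : ZMod ℓ) :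
    linearCycleEdge r ℓ i ∩ linearCycleEdge r ℓ (i + 1) = {Sum.inl (i + 1)} := by
  have : Fact (1 < ℓ) := ⟨by omega⟩
  have h2 : (1 + 1 : ZMod ℓ) ≠ 0 := by
    intro h
    have h' : ((2 : ℕ) : ZMod ℓ) = 0 := by push_cast; rw [← h]; ring
    rw [ZMod.natCast_eq_zero_iff] at h'
    have := Nat.le_of_dvd (by omega) h'
    omega
  ext (x | p)
  · simp only [Set.mem_inter_iff, mem_linearCycleEdge_inl, Set.mem_singleton_iff, Sum.inl.injEq]
    constructor
    · rintro ⟨rfl | h, h' | h'⟩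
      · simp at h'
      · exact absurd (by rwa [add_assoc, left_eq_add] at h') h2
      · exact h
      · exact h
    · intro h
      exact ⟨Or.inr h, Or.inl h⟩
  · simp only [Set.mem_inter_iff, mem_linearCycleEdge_inr, Set.mem_singleton_iff, reduceCtorEq,
      iff_false, not_and]
    intro h h'
    simp [h] at h'

/-- Non-consecutive edges of `C^r_ℓ` are disjoint. -/
theorem linearCycleEdge_inter_eq_empty {r ℓ : ℕ} {i j : ZMod ℓ} (h₀ : i ≠ j) (h₁ : j ≠ i + 1)
    (h₂ : i ≠ j + 1) : linearCycleEdge r ℓ i ∩ linearCycleEdge r ℓ j = ∅ := by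
  ext (x | p)
  · simp only [Set.mem_inter_iff, mem_linearCycleEdge_inl, Set.mem_empty_iff_false, iff_false]
    rintro ⟨rfl | rfl, h | h⟩
    · exact h₀ h
    · exact h₂ h
    · exact h₁ h.symm
    · exact h₀ (add_right_cancel h)
  · simp only [Set.mem_inter_iff, mem_linearCycleEdge_inr, Set.mem_empty_iff_false, iff_false]
    rintro ⟨h, h'⟩
    exact h₀ (h.symm.trans h')

end CycleComplete

/-! Let H be the red r-graph and ℓ = 2m + 1. The edges of H are replaced by the family B of minimal
`Fat` sets with at least two elements. A linear cycle in B lifts to one in H, because a fat set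
extends to an edge avoiding any small set elsewhere (`IsLinCycle.exists_edges_of_fat`). Every red
edge contains a member of B, so a B-independent set spans only blue edges. By minimality, two
vertices lie in boundedly many members of B (`card_minFat_superset_le`). What remains is to find a
large independent set in a family of bounded pair degree without a linear ℓ-cycle.

As for odd cycles in graphs, consider the level of ends of linear paths of length j from a vertex v.
If 2j < ℓ, the level has an independent subset of constant density (`exists_indep_subset_level`):
otherwise it contains a long linear path whose vertices are reached from v by branches of one common
pattern, and a segment of it closes through two branches to an ℓ-cycle
(`exists_linCycle_of_branches`).

If all independent sets have fewer than t elements, level m - 1 has O(t) vertices, so the closed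
neighbourhood of some earlier or equal level is only O(t^(1/(m-1))) times larger than that level.
Keeping an independent part of it, deleting the neighbourhood and repeating gives an independent set
of density of order t^(-1/(m-1)) (`exists_large_indep`); it reaches size t once n is of order
t^(m/(m-1)). -/

namespace CycleComplete

/-! ### Linear cycles, fat sets and minimal fat sets -/

section Cycles

variable {α : Type*}

/-- The sets `E 0, …, E (ℓ - 1)` form a linear cycle with consecutive meeting points
`w 0, …, w (ℓ - 1)`, where `w (i + 1)` joins `E i` and `E (i + 1)`. The sizes are arbitrary. -/
structure IsLinCycle (ℓ : ℕ) (E : ℕ → Finset α) (w : ℕ → α) : Prop where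
  left : ∀ i < ℓ, w i ∈ E i
  right : ∀ i, i + 1 < ℓ → w (i + 1) ∈ E i
  close : w 0 ∈ E (ℓ - 1)
  inter : ∀ i j, i < j → j < ℓ → ∀ v ∈ E i, v ∈ E j →
    (j = i + 1 ∧ v = w j) ∨ (i = 0 ∧ j + 1 = ℓ ∧ v = w 0)

/-- The sets `E 0, …, E (k - 1)` form a linear path through the vertices `w 0, …, w k`. -/
structure IsLinPath (k : ℕ) (E : ℕ → Finset α) (w : ℕ → α) : Prop where
  left : ∀ i < k, w i ∈ E i
  right : ∀ i < k, w (i + 1) ∈ E i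
  ne : ∀ i < k, w i ≠ w (i + 1)
  inter : ∀ i j, i < j → j < k → ∀ v ∈ E i, v ∈ E j → j = i + 1 ∧ v = w j

/-- A repeated meeting point would lie in two sets at cyclic distance two, which are disjoint when ℓ
≥ 4. For ℓ = 3 a vertex common to all three sets is not excluded. -/
theorem IsLinCycle.vertex_ne {ℓ : ℕ} (hℓ : 4 ≤ ℓ) {E : ℕ → Finset α} {w : ℕ → α}
    (h : IsLinCycle ℓ E w) {i j : ℕ} (hij : i < j) (hj : j < ℓ) : w i ≠ w j := by
  intro hw
  have hi : w i ∈ E i := h.left i (by omega)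
  have hj' : w i ∈ E j := hw ▸ h.left j hj
  rcases h.inter i j hij hj _ hi hj' with ⟨rfl, -⟩ | ⟨rfl, hjl, -⟩
  · rcases Nat.eq_zero_or_pos i with rfl | hpos
    · have := h.inter 1 (ℓ - 1) (by omega) (by omega) _ hj' h.close
      omega
    · have h3 := h.right (i - 1) (by omega)
      rw [Nat.sub_add_cancel hpos] at h3
      have := h.inter (i - 1) (i + 1) (by omega) (by omega) _ h3 hj'
      omega
  · have h3 := h.right (j - 1) (by omega)
    rw [Nat.sub_add_cancel hij, ← hw] at h3
    have := h.inter 0 (j - 1) (by omega) (by omega) _ hi h3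
    omega

variable [DecidableEq α]

/-- A set is fat if it is an edge, or the kernel of a sunflower with `K` nonempty petals whose
members are fat. -/
inductive Fat (H : Finset (Finset α)) (K : ℕ) : Finset α → Prop
  | edge (e : Finset α) (he : e ∈ H) : Fat H K e
  | kernel (S : Finset α) (p : Fin K → Finset α) (hp : ∀ i, Fat H K (p i))
      (hS : ∀ i, S ⊂ p i) (hi : ∀ i j, i ≠ j → p i ∩ p j = S) : Fat H K S

/-- The K petals are disjoint outside the kernel, so one of them misses a set of fewer than K
vertices there; repeat with that petal down to an edge. -/
theorem Fat.exists_edge {H : Finset (Finset α)} {K : ℕ} {S : Finset α} (h : Fat H K S)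
    (X : Finset α) (hX : X.card < K) : ∃ e ∈ H, S ⊆ e ∧ ∀ v ∈ e, v ∈ X → v ∈ S := by
  induction h with
  | edge e he => exact ⟨e, he, subset_rfl, fun v hv _ => hv⟩
  | kernel S p hp hS hi ih =>
    obtain ⟨i, hpi⟩ : ∃ i, ∀ v ∈ p i, v ∈ X → v ∈ S := by
      by_contra! hcon
      choose f hf hfX hfS using hcon
      have hinj : Function.Injective f := by
        intro a b hab
        by_contra hne
        exact hfS a (by rw [← hi a b hne]; exact Finset.mem_inter.2 ⟨hf a, hab ▸ hf b⟩)
      have := Finset.card_le_card_of_injOn (s := Finset.univ) (t := X) f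
        (fun a _ => hfX a) hinj.injOn
      simp at this
      omega
    obtain ⟨e, he, hpe, hv⟩ := ih i
    exact ⟨e, he, (hS i).1.trans hpe, fun v hve hvX => hpi v (hv v hve hvX) hvX⟩

theorem Fat.card_le {H : Finset (Finset α)} {K r : ℕ} (hH : ∀ e ∈ H, e.card = r) (hK : 0 < K)
    {S : Finset α} (h : Fat H K S) : S.card ≤ r := by
  obtain ⟨e, he, hSe, -⟩ := h.exists_edge ∅ (by simpa using hK)
  exact hH e he ▸ Finset.card_le_card hSe

/-- A linear cycle of fat sets extends to a linear cycle of edges. -/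
theorem IsLinCycle.exists_edges_of_fat {H : Finset (Finset α)} {K r ℓ : ℕ}
    (hH : ∀ e ∈ H, e.card = r) (hK : ℓ * r < K) {E : ℕ → Finset α} {w : ℕ → α}
    (hE : IsLinCycle ℓ E w) (hfat : ∀ i < ℓ, Fat H K (E i)) :
    ∃ E' : ℕ → Finset α, IsLinCycle ℓ E' w ∧ ∀ i < ℓ, E' i ∈ H := by
  suffices h : ∀ k ≤ ℓ, ∃ E' : ℕ → Finset α, IsLinCycle ℓ E' w ∧ (∀ i < k, E' i ∈ H) ∧
      ∀ i < ℓ, Fat H K (E' i) by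
    obtain ⟨E', h1, h2, -⟩ := h ℓ le_rfl
    exact ⟨E', h1, h2⟩
  intro k
  induction k with
  | zero => exact fun _ => ⟨E, hE, by simp, hfat⟩
  | succ k ih =>
    intro hk
    obtain ⟨E', h1, h2, h3⟩ := ih (by omega)
    -- The sets are replaced one at a time. The vertices added to `E' k` avoid all current sets,
    -- which cover at most ℓ * r < K vertices, so no intersection changes.
    obtain ⟨e, he, hsub, hX⟩ := (h3 k (by omega)).exists_edge
      ((Finset.range ℓ).biUnion E') (by
        refine lt_of_le_of_lt (Finset.card_biUnion_le_card_mul _ _ r fun i hi => ?_) (by simpa)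
        exact (h3 i (Finset.mem_range.1 hi)).card_le hH (by omega))
    have hX' : ∀ i < ℓ, ∀ v ∈ e, v ∈ E' i → v ∈ E' k := fun i hi v hv hvi =>
      hX v hv (Finset.mem_biUnion.2 ⟨i, Finset.mem_range.2 hi, hvi⟩)
    have hmono : ∀ i, E' i ⊆ Function.update E' k e i := by
      intro i
      by_cases hik : i = k
      · subst hik; simpa using hsub
      · simp [hik]
    refine ⟨Function.update E' k e, ⟨fun i hi => hmono i (h1.left i hi),
      fun i hi => hmono i (h1.right i hi), hmono _ h1.close, ?_⟩, ?_, ?_⟩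
    · intro i j hij hj v hvi hvj
      by_cases hik : i = k
      · subst hik
        simp only [Function.update_self] at hvi
        rw [Function.update_of_ne (by omega)] at hvj
        exact h1.inter i j hij hj v (hX' j hj v hvi hvj) hvj
      · rw [Function.update_of_ne hik] at hvi
        by_cases hjk : j = k
        · subst hjk
          simp only [Function.update_self] at hvj
          exact h1.inter i j hij hj v hvi (hX' i (by omega) v hvj hvi)
        · rw [Function.update_of_ne hjk] at hvj
          exact h1.inter i j hij hj v hvi hvj
    · intro i hi
      by_cases hik : i = k
      · subst hik; simpa using he
      · rw [Function.update_of_ne hik]; exact h2 i (by omega)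
    · intro i hi
      by_cases hik : i = k
      · subst hik; simpa using Fat.edge e he
      · rw [Function.update_of_ne hik]; exact h3 i hi

/-- The minimal fat sets with at least two elements. -/
def MinFat (H : Finset (Finset α)) (K : ℕ) (S : Finset α) : Prop :=
  2 ≤ S.card ∧ Fat H K S ∧ ∀ T ⊂ S, 2 ≤ T.card → ¬ Fat H K T

theorem exists_minFat_subset {H : Finset (Finset α)} {K : ℕ} {S : Finset α} (hS : 2 ≤ S.card)
    (hf : Fat H K S) : ∃ T ⊆ S, MinFat H K T := by
  induction S using Finset.strongInduction with
  | H S ih =>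
    by_cases h : ∀ T ⊂ S, 2 ≤ T.card → ¬ Fat H K T
    · exact ⟨S, subset_rfl, hS, hf, h⟩
    · push Not at h
      obtain ⟨T, hTS, hT, hTf⟩ := h
      obtain ⟨T', hT', h'⟩ := ih T hTS hT hTf
      exact ⟨T', hT'.trans hTS.1, h'⟩

/-- Few minimal fat sets contain a given set with at least two elements. -/
theorem card_minFat_superset_le {H : Finset (Finset α)} {K r : ℕ} (hH : ∀ e ∈ H, e.card = r)
    (hK : 0 < K) (hr : 0 < r) {B : Finset (Finset α)} (hB : ∀ e ∈ B, MinFat H K e) (i : ℕ)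
    (S : Finset α) (hS : 2 ≤ S.card) (hi : r ≤ S.card + i) :
    (B.filter (S ⊆ ·)).card ≤ (K * r) ^ i := by
  have hr' : ∀ e ∈ B, e.card ≤ r := fun e he => (hB e he).2.1.card_le hH hK
  have hone : (S ∈ B ∨ r ≤ S.card) → (B.filter (S ⊆ ·)).card ≤ 1 := by
    intro h
    have hsub : B.filter (S ⊆ ·) ⊆ {S} := by
      intro e he
      rw [Finset.mem_filter] at he
      rw [Finset.mem_singleton]
      rcases h with h | h
      · by_contra hne
        exact (hB e he.1).2.2 S (he.2.ssubset_of_ne (Ne.symm hne)) hS (hB S h).2.1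
      · exact (Finset.eq_of_subset_of_card_le he.2 ((hr' e he.1).trans h)).symm
    simpa using Finset.card_le_card hsub
  induction i generalizing S with
  | zero => simpa using hone (Or.inr (by omega))
  | succ i ih =>
    by_cases hSB : S ∈ B
    · exact (hone (Or.inl hSB)).trans (Nat.one_le_pow _ _ (by positivity))
    -- `F` is a largest sunflower with kernel `S` among the members containing `S`. With K petals it
    -- would make `S` fat, against the minimality of its members.
    obtain ⟨F, hF, hmax⟩ := Finset.exists_max_image
      ((B.filter (S ⊆ ·)).powerset.filter
        fun F => ∀ e ∈ F, ∀ f ∈ F, e ≠ f → e ∩ f = S) Finset.card ⟨∅, by simp⟩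
    rw [Finset.mem_filter, Finset.mem_powerset] at hF
    obtain ⟨hFB, hFi⟩ := hF
    have hss : ∀ e ∈ B.filter (S ⊆ ·), S ⊂ e := by
      intro e he
      rw [Finset.mem_filter] at he
      exact he.2.ssubset_of_ne fun h => hSB (h ▸ he.1)
    have hcard : F.card < K := by
      by_contra! hle
      obtain ⟨F', hF', hc⟩ := Finset.exists_subset_card_eq hle
      let g := F'.equivFinOfCardEq hc
      have hfat : Fat H K S := by
        refine Fat.kernel S (fun a => (g.symm a : Finset α)) (fun a => ?_) (fun a => ?_) ?_
        · exact (hB _ (Finset.mem_filter.1 (hFB (hF' (g.symm a).2))).1).2.1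
        · exact hss _ (hFB (hF' (g.symm a).2))
        · intro a b hab
          refine hFi _ (hF' (g.symm a).2) _ (hF' (g.symm b).2) fun h => hab ?_
          exact g.symm.injective (Subtype.ext h)
      have h0 : 0 < F'.card := by omega
      obtain ⟨e, he⟩ := Finset.card_pos.1 h0
      have heB := hFB (hF' he)
      exact (hB e (Finset.mem_filter.1 heB).1).2.2 S (hss e heB) hS hfat
    -- As `F` cannot be enlarged, each member containing `S` meets the union of `F` outside `S`.
    -- This leaves at most K * r ways to enlarge `S` by a vertex.
    have hcover : B.filter (S ⊆ ·) ⊆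
        ((F.biUnion id) \ S).biUnion fun u => B.filter (insert u S ⊆ ·) := by
      intro e he
      have heB := (Finset.mem_filter.1 he).1
      have hSe := (Finset.mem_filter.1 he).2
      suffices h : ∃ u ∈ e, u ∉ S ∧ ∃ f ∈ F, u ∈ f by
        obtain ⟨u, hue, huS, f, hf, huf⟩ := h
        simp only [Finset.mem_biUnion, Finset.mem_sdiff, Finset.mem_filter, id]
        exact ⟨u, ⟨⟨f, hf, huf⟩, huS⟩, heB, Finset.insert_subset hue hSe⟩
      by_contra! hcon
      have heF : e ∉ F := by
        intro heF
        obtain ⟨u, hu, huS⟩ := Finset.exists_of_ssubset (hss e he)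
        exact hcon u hu huS e heF hu
      have hint : ∀ f ∈ F, e ∩ f = S := by
        intro f hf
        apply subset_antisymm
        · intro u hu
          rw [Finset.mem_inter] at hu
          by_contra huS
          exact hcon u hu.1 huS f hf hu.2
        · exact Finset.subset_inter hSe (Finset.mem_filter.1 (hFB hf)).2
      have := hmax (insert e F) (by
        rw [Finset.mem_filter, Finset.mem_powerset]
        refine ⟨Finset.insert_subset he hFB, ?_⟩
        intro a ha b hb hab
        rw [Finset.mem_insert] at ha hb
        rcases ha with rfl | ha <;> rcases hb with rfl | hb
        · exact absurd rfl hab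
        · exact hint b hb
        · rw [Finset.inter_comm]; exact hint a ha
        · exact hFi a ha b hb hab)
      rw [Finset.card_insert_of_notMem heF] at this
      omega
    calc (B.filter (S ⊆ ·)).card
        ≤ ((F.biUnion id) \ S).card * (K * r) ^ i := by
          refine (Finset.card_le_card hcover).trans
            (Finset.card_biUnion_le_card_mul _ _ _ fun u hu => ?_)
          have hu' := (Finset.mem_sdiff.1 hu).2
          have hc := Finset.card_insert_of_notMem hu'
          refine ih (insert u S) (by omega) (by omega) fun h => ?_
          have hsub : B.filter (insert u S ⊆ ·) ⊆ {insert u S} := by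
            intro e he
            rw [Finset.mem_filter] at he
            rw [Finset.mem_singleton]
            rcases h with h | h
            · by_contra hne
              exact (hB e he.1).2.2 _ (he.2.ssubset_of_ne (Ne.symm hne)) (by omega)
                (hB _ h).2.1
            · exact (Finset.eq_of_subset_of_card_le he.2 ((hr' e he.1).trans h)).symm
          simpa using Finset.card_le_card hsub
      _ ≤ (K * r) * (K * r) ^ i := by
          refine Nat.mul_le_mul_right _ ?_
          refine (Finset.card_le_card Finset.sdiff_subset).trans
            ((Finset.card_biUnion_le_card_mul _ _ r fun e he =>
              hr' e (Finset.mem_filter.1 (hFB he)).1).trans ?_)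
          exact Nat.mul_le_mul_right _ hcard.le
      _ = (K * r) ^ (i + 1) := by ring

end Cycles

/-! ### Independent sets or long linear paths of one type -/

section Chains

variable {α : Type*}

/-- `HasHeight F K s t i x`: from `x` one can make `i` steps along arcs of `F`, with more than `K`
choices at every step. -/
def HasHeight {ι : Type*} (F : Finset ι) (K : ℕ) (s t : ι → α) : ℕ → α → Prop
  | 0, _ => True
  | i + 1, x => ∃ F' ⊆ F, K < F'.card ∧ ∀ e ∈ F', s e = x ∧ HasHeight F K s t i (t e)

theorem HasHeight.of_succ {ι : Type*} {F : Finset ι} {K : ℕ} {s t : ι → α} {i : ℕ} {x : α}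
    (h : HasHeight F K s t (i + 1) x) : HasHeight F K s t i x := by
  induction i generalizing x with
  | zero => trivial
  | succ i ih =>
    obtain ⟨F', h1, h2, h3⟩ := h
    exact ⟨F', h1, h2, fun e he => ⟨(h3 e he).1, ih (h3 e he).2⟩⟩

variable [DecidableEq α]

/-- Every two distinct vertices lie in at most `D` common members of `B`. -/
def PairDegreeLE (B : Finset (Finset α)) (D : ℕ) : Prop :=
  ∀ x y, x ≠ y → (B.filter fun e => x ∈ e ∧ y ∈ e).card ≤ D

/-- No member of `B` is contained in `I`. -/
def Indep (B : Finset (Finset α)) (I : Finset α) : Prop :=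
  ∀ e ∈ B, ¬ e ⊆ I

theorem exists_large_fiber {ι κ : Type*} [Fintype κ] [DecidableEq κ] (s : Finset ι)
    (f : ι → κ) (hs : s.Nonempty) :
    ∃ k, s.card ≤ Fintype.card κ * (s.filter fun x => f x = k).card := by
  have : Nonempty κ := ⟨f hs.choose⟩
  obtain ⟨k, -, hk⟩ := Finset.exists_max_image (Finset.univ : Finset κ)
    (fun k => (s.filter fun x => f x = k).card) Finset.univ_nonempty
  refine ⟨k, ?_⟩
  rw [Finset.card_eq_sum_card_fiberwise (t := Finset.univ) (f := f) (by simp)]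
  exact (Finset.sum_le_card_nsmul _ _ _ hk).trans (by simp)

/-- A digraph with bounded out-degree, given as a family of arcs, has a large independent set. -/
theorem exists_indep_of_outDegree_le {ι : Type*} [DecidableEq ι] (K : ℕ) (s t : ι → α)
    (W : Finset α) (F : Finset ι) (hne : ∀ e ∈ F, s e ≠ t e)
    (hK : ∀ x ∈ W, (F.filter fun e => s e = x ∧ t e ∈ W).card ≤ K) :
    ∃ I ⊆ W, (∀ e ∈ F, ¬ (s e ∈ I ∧ t e ∈ I)) ∧ W.card ≤ (2 * K + 1) * I.card := by
  induction W using Finset.strongInduction with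
  | H W ih =>
    rcases W.eq_empty_or_nonempty with rfl | hW
    · exact ⟨∅, by simp⟩
    -- In-degrees and out-degrees have the same sum, so some vertex also has in-degree at most K.
    -- Choosing it costs at most 2K + 1 vertices.
    obtain ⟨x, hx, hin⟩ : ∃ x ∈ W, (F.filter fun e => s e ∈ W ∧ t e = x).card ≤ K := by
      by_contra! hcon
      have h1 : (F.filter fun e => s e ∈ W ∧ t e ∈ W).card =
          ∑ x ∈ W, (F.filter fun e => s e = x ∧ t e ∈ W).card := by
        rw [Finset.card_eq_sum_card_fiberwise (t := W) (f := s)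
          (fun e he => (Finset.mem_filter.1 he).2.1)]
        refine Finset.sum_congr rfl fun x hx => congrArg _ ?_
        ext e
        simp only [Finset.mem_filter]
        constructor
        · rintro ⟨⟨a, b, c⟩, d⟩; exact ⟨a, d, c⟩
        · rintro ⟨a, rfl, c⟩; exact ⟨⟨a, hx, c⟩, rfl⟩
      have h2 : (F.filter fun e => s e ∈ W ∧ t e ∈ W).card =
          ∑ x ∈ W, (F.filter fun e => s e ∈ W ∧ t e = x).card := by
        rw [Finset.card_eq_sum_card_fiberwise (t := W) (f := t)
          (fun e he => (Finset.mem_filter.1 he).2.2)]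
        refine Finset.sum_congr rfl fun x hx => congrArg _ ?_
        ext e
        simp only [Finset.mem_filter]
        constructor
        · rintro ⟨⟨a, b, c⟩, d⟩; exact ⟨a, b, d⟩
        · rintro ⟨a, c, rfl⟩; exact ⟨⟨a, c, hx⟩, rfl⟩
      have h3 := Finset.sum_le_sum hK
      have h4 := Finset.sum_lt_sum_of_nonempty hW hcon
      omega
    let N : Finset α := insert x ((F.filter fun e => s e = x ∧ t e ∈ W).image t ∪
      (F.filter fun e => s e ∈ W ∧ t e = x).image s)
    have hNcard : N.card ≤ 2 * K + 1 := by
      refine (Finset.card_insert_le _ _).trans (Nat.succ_le_succ ?_)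
      refine (Finset.card_union_le _ _).trans ?_
      have h1 := (Finset.card_image_le (f := t)).trans (hK x hx)
      have h2 := (Finset.card_image_le (f := s)).trans hin
      omega
    have hxN : x ∈ N := Finset.mem_insert_self _ _
    obtain ⟨I, hI, hind, hcard⟩ := ih (W \ N)
      ⟨Finset.sdiff_subset, fun h => (Finset.mem_sdiff.1 (h hx)).2 hxN⟩
      (fun y hy => (Finset.card_le_card fun e he => by
        simp only [Finset.mem_filter, Finset.mem_sdiff] at he ⊢
        exact ⟨he.1, he.2.1, he.2.2.1⟩).trans (hK y (Finset.mem_sdiff.1 hy).1))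
    have hxI : x ∉ I := fun h => (Finset.mem_sdiff.1 (hI h)).2 hxN
    refine ⟨insert x I, Finset.insert_subset hx (hI.trans Finset.sdiff_subset), ?_, ?_⟩
    · rintro e he ⟨h1, h2⟩
      rw [Finset.mem_insert] at h1 h2
      rcases h1 with h1 | h1 <;> rcases h2 with h2 | h2
      · exact hne e he (h1.trans h2.symm)
      · refine (Finset.mem_sdiff.1 (hI h2)).2 (Finset.mem_insert_of_mem
          (Finset.mem_union_left _ (Finset.mem_image_of_mem t ?_)))
        exact Finset.mem_filter.2 ⟨he, h1, (Finset.mem_sdiff.1 (hI h2)).1⟩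
      · refine (Finset.mem_sdiff.1 (hI h1)).2 (Finset.mem_insert_of_mem
          (Finset.mem_union_right _ (Finset.mem_image_of_mem s ?_)))
        exact Finset.mem_filter.2 ⟨he, (Finset.mem_sdiff.1 (hI h1)).1, h2⟩
      · exact hind e he ⟨h1, h2⟩
    · rw [Finset.card_insert_of_notMem hxI]
      have h1 := Finset.card_le_card_sdiff_add_card (s := W) (t := N)
      rw [Nat.mul_add_one]
      omega

/-- A vertex of large height starts a linear path avoiding a given small set. -/
theorem HasHeight.exists_path {B : Finset (Finset α)} {D r K : ℕ} (hD : PairDegreeLE B D)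
    (hr : ∀ e ∈ B, e.card ≤ r) {F : Finset (Finset α)} (hF : F ⊆ B) {s t : Finset α → α}
    (hs : ∀ e ∈ F, s e ∈ e) (ht : ∀ e ∈ F, t e ∈ e) (hst : ∀ e ∈ F, s e ≠ t e)
    (i : ℕ) (x : α) (X : Finset α) (hx : x ∉ X) (hX : (X.card + i * r) * D ≤ K)
    (h : HasHeight F K s t i x) :
    ∃ E w, IsLinPath i E w ∧ w 0 = x ∧
      ∀ j < i, E j ∈ F ∧ Disjoint (E j) X ∧ s (E j) = w j ∧ t (E j) = w (j + 1) := by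
  induction i generalizing x X with
  | zero =>
    exact ⟨fun _ => ∅, fun _ => x, ⟨by simp, by simp, by simp, by simp⟩, rfl, by simp⟩
  | succ i ih =>
    obtain ⟨F', hF', hK, hstep⟩ := h
    -- Each vertex of `X` spoils at most `D` arcs at `x`, since `x` is not in `X`.
    obtain ⟨e, he, heX⟩ : ∃ e ∈ F', Disjoint e X := by
      by_contra! hcon
      have hsub : F' ⊆ X.biUnion fun u => B.filter fun e => x ∈ e ∧ u ∈ e := by
        intro e he
        obtain ⟨u, hue, huX⟩ := Finset.not_disjoint_iff.1 (hcon e he)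
        simp only [Finset.mem_biUnion, Finset.mem_filter]
        exact ⟨u, huX, hF (hF' he), (hstep e he).1 ▸ hs e (hF' he), hue⟩
      have := (Finset.card_le_card hsub).trans (Finset.card_biUnion_le_card_mul _ _ D
        fun u hu => hD x u fun h => hx (h ▸ hu))
      have h2 : X.card * D ≤ (X.card + (i + 1) * r) * D := Nat.mul_le_mul_right _ (by omega)
      omega
    have heF := hF' he
    -- Forbidding `e` except for its end makes the rest of the path meet `e` only there; this uses
    -- up to r of the budget i * r.
    obtain ⟨E, w, hP, hw, hprop⟩ := ih (t e) (X ∪ e.erase (t e))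
      (by
        rw [Finset.mem_union, not_or]
        exact ⟨fun h => Finset.disjoint_left.1 heX (ht e heF) h, by simp⟩)
      (by
        refine le_trans (Nat.mul_le_mul_right _ ?_) hX
        have h1 := Finset.card_union_le X (e.erase (t e))
        have h2 := (Finset.card_erase_le (s := e) (a := t e)).trans (hr e (hF heF))
        have h3 : (i + 1) * r = i * r + r := by ring
        omega)
      (hstep e he).2
    refine ⟨fun j => if j = 0 then e else E (j - 1), fun j => if j = 0 then x else w (j - 1),
      ⟨?_, ?_, ?_, ?_⟩, by simp, ?_⟩
    · intro j hj
      rcases j with _ | j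
      · simpa [(hstep e he).1] using hs e heF
      · simpa using hP.left j (by omega)
    · intro j hj
      rcases j with _ | j
      · simpa [hw] using ht e heF
      · simpa using hP.right j (by omega)
    · intro j hj
      rcases j with _ | j
      · simpa [hw, (hstep e he).1] using hst e heF
      · simpa using hP.ne j (by omega)
    · intro a b hab hb v hva hvb
      obtain ⟨b, rfl⟩ : ∃ b', b = b' + 1 := ⟨b - 1, by omega⟩
      simp only [Nat.add_eq_zero_iff, one_ne_zero, and_false, if_false,
        Nat.add_sub_cancel] at hvb ⊢
      rcases a with _ | a
      · simp only [if_true] at hva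
        have hvt : v = t e := by
          by_contra hne
          refine Finset.disjoint_left.1 (hprop b (by omega)).2.1 hvb ?_
          exact Finset.mem_union_right _ (Finset.mem_erase.2 ⟨hne, hva⟩)
        rcases Nat.eq_zero_or_pos b with rfl | hpos
        · exact ⟨rfl, by rw [hvt, hw]⟩
        · have h0 := hP.left 0 (by omega)
          rw [hw, ← hvt] at h0
          obtain ⟨rfl, h2⟩ := hP.inter 0 b hpos (by omega) v h0 hvb
          exact absurd (by rw [hw, ← hvt, h2]) (hP.ne 0 (by omega))
      · simp only [Nat.add_eq_zero_iff, one_ne_zero, and_false, if_false,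
          Nat.add_sub_cancel] at hva
        have := hP.inter a b (by omega) (by omega) v hva hvb
        exact ⟨by omega, this.2⟩
    · intro j hj
      rcases j with _ | j
      · simp only [if_true, Nat.zero_add, one_ne_zero, if_false, Nat.sub_self]
        exact ⟨heF, heX, (hstep e he).1, hw.symm⟩
      · simp only [Nat.add_eq_zero_iff, one_ne_zero, and_false, if_false, Nat.add_sub_cancel]
        obtain ⟨h1, h2, h3, h4⟩ := hprop j (by omega)
        exact ⟨h1, (Finset.disjoint_union_right.1 h2).1, h3, h4⟩

/-- In a family of small sets with bounded pair degrees, every vertex set `L` contains a large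
independent set or a linear path of length `k` whose consecutive vertices all have the same type. -/
theorem exists_indep_or_monochromatic_path {B : Finset (Finset α)} {D r : ℕ}
    (hD : PairDegreeLE B D) (hr : ∀ e ∈ B, e.card ≤ r) (h2 : ∀ e ∈ B, 2 ≤ e.card)
    {T : Type*} [Fintype T] [DecidableEq T] (τ : α → α → T) (k : ℕ) (L : Finset α) :
    (∃ I ⊆ L, Indep B I ∧ L.card ≤
      (k + 1) ^ Fintype.card T * (2 * (Fintype.card T * (k * r * D)) + 1) * I.card) ∨
    ∃ E w c, IsLinPath k E w ∧
      ∀ j < k, E j ∈ B ∧ E j ⊆ L ∧ τ (w j) (w (j + 1)) = c := by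
  classical
  rcases L.eq_empty_or_nonempty with rfl | hL
  · refine Or.inl ⟨∅, subset_rfl, fun e he hsub => ?_, by simp⟩
    have := h2 e he
    simp [Finset.subset_empty.1 hsub] at this
  -- One ordered pair inside each member serves as its arc: a set that contains no arc contains no
  -- member.
  have hpair : ∀ e, ∃ p : α × α, e ∈ B → p.1 ∈ e ∧ p.2 ∈ e ∧ p.1 ≠ p.2 := by
    intro e
    by_cases he : e ∈ B
    · obtain ⟨a, ha, b, hb, hab⟩ := Finset.one_lt_card.1 (h2 e he)
      exact ⟨(a, b), fun _ => ⟨ha, hb, hab⟩⟩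
    · exact ⟨(hL.choose, hL.choose), fun h => absurd h he⟩
  choose p hp using hpair
  let s : Finset α → α := fun e => (p e).1
  let t : Finset α → α := fun e => (p e).2
  let F : T → Finset (Finset α) := fun c => B.filter fun e => e ⊆ L ∧ τ (s e) (t e) = c
  have hFB : ∀ c, F c ⊆ B := fun c => Finset.filter_subset _ _
  set K := k * r * D with hKdef
  by_cases hex : ∃ c x, HasHeight (F c) K s t k x
  · right
    obtain ⟨c, x, hx⟩ := hex
    obtain ⟨E, w, hP, -, hprop⟩ := hx.exists_path hD hr (hFB c)
      (fun e he => (hp e (hFB c he)).1) (fun e he => (hp e (hFB c he)).2.1)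
      (fun e he => (hp e (hFB c he)).2.2) k x ∅ (by simp) (by simp [hKdef])
    refine ⟨E, w, c, hP, fun j hj => ?_⟩
    obtain ⟨h1, -, h3, h4⟩ := hprop j hj
    have := Finset.mem_filter.1 h1
    exact ⟨this.1, this.2.1, by rw [← h3, ← h4]; exact this.2.2⟩
  · left
    push Not at hex
    -- Vertices are classified by their heights in all types, which costs the factor (k + 1) ^ |T|.
    -- Height 0 always holds, so the maximum is attained.
    let ht : α → T → Fin (k + 1) := fun x c =>
      ⟨Nat.findGreatest (fun i => HasHeight (F c) K s t i x) k,
        Nat.lt_succ_of_le (Nat.findGreatest_le k)⟩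
    have hht : ∀ x c, HasHeight (F c) K s t (ht x c) x := fun x c =>
      Nat.findGreatest_spec (P := fun i => HasHeight (F c) K s t i x) (Nat.zero_le k) trivial
    have hht' : ∀ x c, ¬ HasHeight (F c) K s t (ht x c + 1) x := by
      intro x c h
      have hle : (ht x c : ℕ) ≤ k := Nat.findGreatest_le k
      rcases hle.lt_or_eq with hlt | heq
      · exact Nat.findGreatest_is_greatest (P := fun i => HasHeight (F c) K s t i x)
          (n := k) (k := ht x c + 1) (Nat.lt_succ_self _) hlt h
      · exact hex c x (heq ▸ h.of_succ)
    obtain ⟨κ, hκ⟩ := exists_large_fiber L ht hL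
    set W := L.filter fun x => ht x = κ with hW
    obtain ⟨I, hI, hind, hcard⟩ := exists_indep_of_outDegree_le (Fintype.card T * K) s t W
      (B.filter (· ⊆ L)) (fun e he => (hp e (Finset.mem_filter.1 he).1).2.2) (by
        intro x hx
        have hsub : ((B.filter (· ⊆ L)).filter fun e => s e = x ∧ t e ∈ W) ⊆
            Finset.univ.biUnion fun c : T => (F c).filter fun e => s e = x ∧ t e ∈ W := by
          intro e he
          simp only [Finset.mem_filter, Finset.mem_biUnion, Finset.mem_univ, true_and, F] at he ⊢
          exact ⟨_, ⟨he.1.1, he.1.2, rfl⟩, he.2⟩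
        refine (Finset.card_le_card hsub).trans ?_
        refine (Finset.card_biUnion_le_card_mul _ _ K fun c _ => ?_).trans (by simp)
        -- Heights are constant on `W`, so more than K arcs of type `c` from `x` into `W` would
        -- raise the height of `x` by one.
        by_contra! hlt
        refine hht' x c ⟨_, Finset.filter_subset _ _, hlt, fun e he => ?_⟩
        obtain ⟨-, h1, h2⟩ := Finset.mem_filter.1 he
        refine ⟨h1, ?_⟩
        have h3 : ht (t e) = ht x := by
          rw [(Finset.mem_filter.1 h2).2, (Finset.mem_filter.1 hx).2]
        rw [← h3]
        exact hht (t e) c)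
    refine ⟨I, hI.trans (Finset.filter_subset _ _), ?_, ?_⟩
    · intro e he hsub
      refine hind e (Finset.mem_filter.2 ⟨he, hsub.trans (hI.trans (Finset.filter_subset _ _))⟩)
        ⟨hsub (hp e he).1, hsub (hp e he).2.1⟩
    · calc L.card ≤ (k + 1) ^ Fintype.card T * W.card := by simpa using hκ
        _ ≤ _ := by rw [mul_assoc]; exact Nat.mul_le_mul_left _ hcard

end Chains

/-! ### Closing a path and two branches to a cycle -/

section Closing

variable {α : Type*}

theorem IsLinPath.eq_or_of_mem {k : ℕ} {E : ℕ → Finset α} {w : ℕ → α} (h : IsLinPath k E w)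
    {a i : ℕ} (ha : a ≤ k) (hi : i < k) (hm : w a ∈ E i) : i = a ∨ i + 1 = a := by
  rcases lt_trichotomy i a with hia | hia | hia
  · right
    have h1 := h.right (a - 1) (by omega)
    rw [Nat.sub_add_cancel (by omega)] at h1
    rcases Nat.lt_or_ge i (a - 1) with hlt | hge
    · have h2 := h.inter i (a - 1) hlt (by omega) _ hm h1
      have h3 := h.ne (a - 1) (by omega)
      rw [Nat.sub_add_cancel (by omega)] at h3
      exact absurd h2.2.symm h3
    · omega
  · exact Or.inl hia
  · have h2 := h.inter a i hia hi _ (h.left a (by omega)) hm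
    obtain ⟨rfl, h2⟩ := h2
    exact absurd h2 (h.ne a (by omega))

theorem IsLinPath.vertex_ne {k : ℕ} {E : ℕ → Finset α} {w : ℕ → α} (h : IsLinPath k E w)
    {i j : ℕ} (hij : i < j) (hj : j ≤ k) : w i ≠ w j := by
  intro hw
  have h1 := h.eq_or_of_mem hj (by omega) (hw ▸ h.left i (by omega))
  obtain rfl : i + 1 = j := by omega
  exact h.ne i (by omega) hw

variable [DecidableEq α]

/-- A long linear path whose vertices `y i` are the ends of linear paths `G i` from a common root
closes up to a linear cycle of length `ℓ`, provided that vertices common to two of the paths `G i`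
are common to all of them, at the same position. -/
theorem exists_linCycle_of_branches {B : Finset (Finset α)} {D j k ℓ : ℕ}
    (hD : PairDegreeLE B D) (hj : 0 < j) (hkD : D ≤ k) (hkℓ : ℓ ≤ k) (hℓ : 2 * j < ℓ)
    {F : ℕ → Finset α} {y : ℕ → α} {G : ℕ → ℕ → Finset α} {p : ℕ → ℕ → α} {v : α}
    (hF : IsLinPath k F y) (hFB : ∀ i < k, F i ∈ B)
    (hG : ∀ i ≤ k, IsLinPath j (G i) (p i)) (hGB : ∀ i ≤ k, ∀ l < j, G i l ∈ B)
    (h0 : ∀ i ≤ k, p i 0 = v) (hend : ∀ i ≤ k, p i j = y i)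
    (hcommon : ∀ i ≤ k, ∀ i' ≤ k, i ≠ i' → ∀ l < j, ∀ l' < j, ∀ u ∈ G i l, u ∈ G i' l' →
      ∀ a ≤ k, u ∈ G a l)
    (hp : ∀ i ≤ k, ∀ i' ≤ k, ∀ l < j, p i (l + 1) ∈ G i' l → p i (l + 1) = p i' (l + 1))
    (hFG : ∀ i < k, ∀ i' ≤ k, ∀ l < j, ∀ u ∈ F i, u ∈ G i' l → u = y i') :
    ∃ C W, IsLinCycle ℓ C W ∧ ∀ i < ℓ, C i ∈ B := by
  classical
  -- `s` is the last position at which all branches share a vertex; beyond it they are disjoint from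
  -- each other. Position 0 qualifies because of the root `v`.
  obtain ⟨s, hsj, ⟨u, hu⟩, hmax⟩ : ∃ s < j, (∃ u, ∀ i ≤ k, u ∈ G i s) ∧
      ∀ l, s < l → l < j → ¬ ∃ u, ∀ i ≤ k, u ∈ G i l := by
    refine ⟨Nat.findGreatest (fun l => ∃ u, ∀ i ≤ k, u ∈ G i l) (j - 1), ?_, ?_, ?_⟩
    · exact lt_of_le_of_lt (Nat.findGreatest_le _) (by omega)
    · exact Nat.findGreatest_spec (P := fun l => ∃ u, ∀ i ≤ k, u ∈ G i l) (Nat.zero_le _)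
        ⟨v, fun i hi => h0 i hi ▸ (hG i hi).left 0 hj⟩
    · exact fun l hl hlj => Nat.findGreatest_is_greatest hl (by omega)
  have hsep : ∀ i ≤ k, ∀ i' ≤ k, i ≠ i' → p i (s + 1) ∉ G i' s := by
    intro i hi i' hi' hne hmem
    have hall := hcommon i hi i' hi' hne s hsj s hsj _ ((hG i hi).right s hsj) hmem
    have heq : ∀ a ≤ k, p i (s + 1) = p a (s + 1) := fun a ha => hp i hi a ha s hsj (hall a ha)
    rcases Nat.lt_or_ge (s + 1) j with hlt | hge
    · exact hmax (s + 1) (by omega) hlt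
        ⟨p i (s + 1), fun a ha => heq a ha ▸ (hG a ha).left (s + 1) hlt⟩
    · obtain rfl : s + 1 = j := by omega
      have hy : y i = y i' := by rw [← hend i hi, ← hend i' hi']; exact heq i' hi'
      rcases lt_or_gt_of_ne hne with h | h
      · exact hF.vertex_ne h hi' hy
      · exact hF.vertex_ne h hi hy.symm
  -- By `hsep` the k + 1 sets `G i s` are distinct, and k + 1 > D, so they cannot share two
  -- vertices.
  have huniq : ∀ u', (∀ i ≤ k, u' ∈ G i s) → u' = u := by
    intro u' hu'
    by_contra hne
    have hinj : Set.InjOn (fun i => G i s) (Finset.range (k + 1) : Set ℕ) := by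
      intro a ha b hb hab
      simp only [Finset.coe_range, Set.mem_Iio] at ha hb
      by_contra hne
      refine hsep a (by omega) b (by omega) hne ?_
      have : G a s = G b s := hab
      rw [← this]
      exact (hG a (by omega)).right s hsj
    have h1 := Finset.card_le_card_of_injOn (s := Finset.range (k + 1))
      (t := B.filter fun e => u' ∈ e ∧ u ∈ e) (fun i => G i s) (by
        intro i hi
        have hi : i ≤ k := by simpa [Nat.lt_succ_iff] using hi
        exact Finset.mem_coe.2 (Finset.mem_filter.2 ⟨hGB i hi s hsj, hu' i hi, hu i hi⟩)) hinj
    have h2 := hD u' u hne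
    rw [Finset.card_range] at h1
    omega
  -- The cycle runs along `F` from `y 0` to `y κ`, down branch κ to position `s`, through `u`, and
  -- up branch 0 to `y 0`. The two branch parts have d sets each, so κ = ℓ - 2d, positive as 2j < ℓ.
  obtain ⟨d, hd⟩ : ∃ d, j = s + d := ⟨j - s, by omega⟩
  obtain ⟨κ, hκ⟩ : ∃ κ, ℓ = κ + d + d := ⟨ℓ - 2 * d, by omega⟩
  have hκpos : 0 < κ := by omega
  have hκk : κ ≤ k := by omega
  let C : ℕ → Finset α := fun i => if i < κ then F i else
    if i < κ + d then G κ (j - 1 - (i - κ)) else G 0 (s + (i - κ - d))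
  let W : ℕ → α := fun i => if i < κ then y i else
    if i < κ + d then p κ (j - (i - κ)) else if i = κ + d then u else p 0 (s + (i - κ - d))
  have C1 : ∀ i < κ, C i = F i := fun i hi => by simp [C, hi]
  have C2 : ∀ l, s ≤ l → l < j → C (κ + (j - 1 - l)) = G κ l := fun l hl hlj => by
    have h1 : ¬ κ + (j - 1 - l) < κ := by omega
    have h2 : κ + (j - 1 - l) < κ + d := by omega
    have h3 : j - 1 - (κ + (j - 1 - l) - κ) = l := by omega
    simp only [C, if_neg h1, if_pos h2, h3]
  have C3 : ∀ l, s ≤ l → l < j → C (κ + d + (l - s)) = G 0 l := fun l hl hlj => by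
    have h1 : ¬ κ + d + (l - s) < κ := by omega
    have h2 : ¬ κ + d + (l - s) < κ + d := by omega
    have h3 : s + (κ + d + (l - s) - κ - d) = l := by omega
    simp only [C, if_neg h1, if_neg h2, h3]
  have W1 : ∀ i ≤ κ, W i = y i := fun i hi => by
    rcases hi.lt_or_eq with hi | rfl
    · simp [W, hi]
    · have h2 : i < i + d := by omega
      simp only [W, lt_irrefl, if_false, if_pos h2, Nat.sub_self, Nat.sub_zero]
      exact hend i hκk
  have W2 : ∀ l, s < l → l ≤ j → W (κ + (j - l)) = p κ l := fun l hl hlj => by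
    have h1 : ¬ κ + (j - l) < κ := by omega
    have h2 : κ + (j - l) < κ + d := by omega
    have h3 : j - (κ + (j - l) - κ) = l := by omega
    simp only [W, if_neg h1, if_pos h2, h3]
  have W3 : W (κ + d) = u := by simp [W]
  have W4 : ∀ l, s < l → l < j → W (κ + d + (l - s)) = p 0 l := fun l hl hlj => by
    have h1 : ¬ κ + d + (l - s) < κ := by omega
    have h2 : ¬ κ + d + (l - s) < κ + d := by omega
    have h4 : ¬ κ + d + (l - s) = κ + d := by omega
    have h3 : s + (κ + d + (l - s) - κ - d) = l := by omega
    simp only [W, if_neg h1, if_neg h2, if_neg h4, h3]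
  have hidx : ∀ i < ℓ, i < κ ∨ (∃ l, s ≤ l ∧ l < j ∧ i = κ + (j - 1 - l)) ∨
      (∃ l, s ≤ l ∧ l < j ∧ i = κ + d + (l - s)) := by
    intro i hi
    rcases Nat.lt_or_ge i κ with h | h
    · exact Or.inl h
    rcases Nat.lt_or_ge i (κ + d) with h' | h'
    · exact Or.inr (Or.inl ⟨j - 1 - (i - κ), by omega, by omega, by omega⟩)
    · exact Or.inr (Or.inr ⟨s + (i - κ - d), by omega, by omega, by omega⟩)
  have hroot : 0 ≤ k := Nat.zero_le k
  have hκ0 : κ ≠ 0 := by omega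
  refine ⟨C, W, ⟨?_, ?_, ?_, ?_⟩, ?_⟩
  · intro i hi
    rcases hidx i hi with h | ⟨l, hl, hlj, rfl⟩ | ⟨l, hl, hlj, rfl⟩
    · rw [C1 i h, W1 i h.le]; exact hF.left i (by omega)
    · rw [C2 l hl hlj, show κ + (j - 1 - l) = κ + (j - (l + 1)) by omega,
        W2 (l + 1) (by omega) (by omega)]
      exact (hG κ hκk).right l hlj
    · rw [C3 l hl hlj]
      rcases hl.lt_or_eq with h | rfl
      · rw [W4 l h hlj]; exact (hG 0 hroot).left l hlj
      · rw [Nat.sub_self, Nat.add_zero, W3]; exact hu 0 hroot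
  · intro i hi
    rcases hidx i (by omega) with h | ⟨l, hl, hlj, rfl⟩ | ⟨l, hl, hlj, rfl⟩
    · rw [C1 i h, W1 (i + 1) h]; exact hF.right i (by omega)
    · rw [C2 l hl hlj]
      rcases hl.lt_or_eq with h | rfl
      · rw [show κ + (j - 1 - l) + 1 = κ + (j - l) by omega, W2 l h hlj.le]
        exact (hG κ hκk).left l hlj
      · rw [show κ + (j - 1 - s) + 1 = κ + d by omega, W3]
        exact hu κ hκk
    · rw [C3 l hl hlj, show κ + d + (l - s) + 1 = κ + d + (l + 1 - s) by omega,
        W4 (l + 1) (by omega) (by omega)]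
      exact (hG 0 hroot).right l hlj
  · rw [W1 0 (by omega), show ℓ - 1 = κ + d + (j - 1 - s) by omega,
      C3 (j - 1) (by omega) (by omega), ← hend 0 hroot]
    have := (hG 0 hroot).right (j - 1) (by omega)
    rwa [Nat.sub_add_cancel hj] at this
  · have hlast : ∀ i ≤ k, ∀ l < j, y i ∈ G i l → l + 1 = j := by
      intro i hi l hl hmem
      rw [← hend i hi] at hmem
      have := (hG i hi).eq_or_of_mem le_rfl hl hmem
      omega
    have hcross : ∀ l, s ≤ l → l < j → ∀ l', s ≤ l' → l' < j → ∀ x ∈ G κ l, x ∈ G 0 l' →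
        l = s ∧ l' = s ∧ x = u := by
      intro l hl hlj l' hl' hlj' x hx hx'
      have h1 := hcommon κ hκk 0 hroot hκ0 l hlj l' hlj' x hx hx'
      have h2 := hcommon 0 hroot κ hκk hκ0.symm l' hlj' l hlj x hx' hx
      have h3 : l = s := by
        by_contra hne
        exact hmax l (by omega) hlj ⟨x, h1⟩
      have h4 : l' = s := by
        by_contra hne
        exact hmax l' (by omega) hlj' ⟨x, h2⟩
      subst h3
      exact ⟨rfl, h4, huniq x h1⟩
    intro a b hab hb x hxa hxb
    rcases hidx a (by omega) with ha | ⟨l, hl, hlj, rfl⟩ | ⟨l, hl, hlj, rfl⟩ <;>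
      rcases hidx b hb with hb' | ⟨l', hl', hlj', rfl⟩ | ⟨l', hl', hlj', rfl⟩
    · rw [C1 a ha] at hxa
      rw [C1 b hb'] at hxb
      rw [W1 b hb'.le]
      exact Or.inl (hF.inter a b hab (by omega) x hxa hxb)
    · rw [C1 a ha] at hxa
      rw [C2 l' hl' hlj'] at hxb
      have hx := hFG a (by omega) κ hκk l' hlj' x hxa hxb
      subst hx
      have h1 := hlast κ hκk l' hlj' hxb
      have h2 := hF.eq_or_of_mem hκk (by omega) hxa
      refine Or.inl ⟨by omega, ?_⟩
      rw [show κ + (j - 1 - l') = κ by omega, W1 κ le_rfl]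
    · rw [C1 a ha] at hxa
      rw [C3 l' hl' hlj'] at hxb
      have hx := hFG a (by omega) 0 hroot l' hlj' x hxa hxb
      subst hx
      have h1 := hlast 0 hroot l' hlj' hxb
      have h2 := hF.eq_or_of_mem hroot (by omega) hxa
      exact Or.inr ⟨by omega, by omega, (W1 0 (by omega)).symm⟩
    · omega
    · rw [C2 l hl hlj] at hxa
      rw [C2 l' hl' hlj'] at hxb
      obtain ⟨h1, h2⟩ := (hG κ hκk).inter l' l (by omega) hlj x hxb hxa
      refine Or.inl ⟨by omega, ?_⟩
      rw [show κ + (j - 1 - l') = κ + (j - l) by omega, W2 l (by omega) (by omega), h2]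
    · rw [C2 l hl hlj] at hxa
      rw [C3 l' hl' hlj'] at hxb
      obtain ⟨rfl, rfl, rfl⟩ := hcross l hl hlj l' hl' hlj' x hxa hxb
      refine Or.inl ⟨by omega, ?_⟩
      rw [Nat.sub_self, Nat.add_zero, W3]
    · omega
    · omega
    · rw [C3 l hl hlj] at hxa
      rw [C3 l' hl' hlj'] at hxb
      obtain ⟨h1, h2⟩ := (hG 0 hroot).inter l l' (by omega) hlj' x hxa hxb
      refine Or.inl ⟨by omega, ?_⟩
      rw [W4 l' (by omega) hlj', h2]
  · intro i hi
    rcases hidx i hi with h | ⟨l, hl, hlj, rfl⟩ | ⟨l, hl, hlj, rfl⟩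
    · rw [C1 i h]; exact hFB i (by omega)
    · rw [C2 l hl hlj]; exact hGB κ hκk l hlj
    · rw [C3 l hl hlj]; exact hGB 0 hroot l hlj

end Closing

/-! ### Colourings injective on many small sets -/

section Colouring

variable {α : Type*} [DecidableEq α] [Fintype α]

/-- Some colouring of the vertices with `M` colours is injective on a constant fraction of the
sets `P x`, if these sets have at most `M` elements. -/
theorem exists_colouring_injOn {ι : Type*} [DecidableEq ι] {M : ℕ} (hM : 0 < M) (L : Finset ι)
    (P : ι → Finset α) (hP : ∀ x ∈ L, (P x).card ≤ M) :
    ∃ χ : α → Fin M, ∃ L' ⊆ L, (∀ x ∈ L', Set.InjOn χ (P x : Set α)) ∧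
      L.card ≤ M ^ M * L'.card := by
  classical
  have : Nonempty (Fin M) := ⟨⟨0, hM⟩⟩
  have key : ∀ x ∈ L, Fintype.card (α → Fin M) ≤
      M ^ M * (Finset.univ.filter fun χ : α → Fin M => Set.InjOn χ (P x : Set α)).card := by
    intro x hx
    obtain ⟨ι₀⟩ : Nonempty (P x ↪ Fin M) := Function.Embedding.nonempty_of_card_le (by
      simpa using hP x hx)
    -- Overwriting a colouring on `P x` by a fixed injection makes it injective there. A fibre is
    -- determined by the lost values, at most M ^ M of them; averaging over all colourings follows.
    let φ : (α → Fin M) → α → Fin M := fun χ v => if h : v ∈ P x then ι₀ ⟨v, h⟩ else χ v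
    refine Finset.card_le_mul_card_image_of_maps_to (s := Finset.univ) (f := φ) ?_ _ ?_
    · intro χ _
      refine Finset.mem_filter.2 ⟨Finset.mem_univ _, ?_⟩
      intro a ha b hb hab
      rw [Finset.mem_coe] at ha hb
      simp only [φ, dif_pos ha, dif_pos hb] at hab
      simpa using ι₀.injective hab
    · intro b _
      refine (Finset.card_le_card_of_injOn (t := (Finset.univ : Finset (P x → Fin M)))
        (fun χ v => χ v) (by simp) ?_).trans ?_
      · intro χ hχ ψ hψ h
        simp only [Finset.coe_filter, Finset.mem_univ, true_and, Set.mem_ofPred_eq] at hχ hψ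
        funext v
        by_cases hv : v ∈ P x
        · exact congrFun h ⟨v, hv⟩
        · have := congrFun (hχ.trans hψ.symm) v
          simpa [φ, hv] using this
      · simpa using Nat.pow_le_pow_right hM (hP x hx)
  by_contra! hcon
  have hlt : ∀ χ : α → Fin M,
      M ^ M * (L.filter fun x => Set.InjOn χ (P x : Set α)).card < L.card := fun χ =>
    hcon χ _ (Finset.filter_subset _ _) fun x hx => (Finset.mem_filter.1 hx).2
  have h1 := Finset.sum_lt_sum_of_nonempty (Finset.univ_nonempty (α := α → Fin M))
    fun χ _ => hlt χ
  have h2 := Finset.sum_le_sum key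
  rw [← Finset.mul_sum] at h1 h2
  have h3 := Finset.sum_card_bipartiteAbove_eq_sum_card_bipartiteBelow
    (s := (Finset.univ : Finset (α → Fin M))) (t := L)
    (fun χ x => Set.InjOn χ (P x : Set α))
  simp only [Finset.bipartiteAbove, Finset.bipartiteBelow] at h3
  rw [h3] at h1
  simp only [Finset.sum_const, smul_eq_mul, Finset.card_univ] at h1 h2
  rw [mul_comm] at h2
  omega

end Colouring

/-! ### Levels of linear paths and their independent subsets -/

section Levels

/-- Equal consecutive comparisons make the sequence strictly monotone or constant, and one
repetition rules out the former. This turns a vertex common to two branches into one common to all.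
-/
theorem cmp_constant_chain {α : Type*} [LinearOrder α] {k : ℕ} {f : ℕ → α} {o : Ordering}
    (h : ∀ i < k, cmp (f i) (f (i + 1)) = o) {i j : ℕ} (hij : i < j) (hj : j ≤ k)
    (hf : f i = f j) : ∀ a ≤ k, f a = f i := by
  cases o with
  | lt =>
    have hlt : ∀ n, i + n + 1 ≤ k → f i < f (i + n + 1) := by
      intro n
      induction n with
      | zero => exact fun hn => (cmp_eq_lt_iff _ _).1 (h i (by omega))
      | succ n ih =>
        exact fun hn => (ih (by omega)).trans ((cmp_eq_lt_iff _ _).1 (h (i + n + 1) (by omega)))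
    obtain ⟨n, rfl⟩ : ∃ n, j = i + n + 1 := ⟨j - i - 1, by omega⟩
    exact absurd hf (hlt n hj).ne
  | gt =>
    have hlt : ∀ n, i + n + 1 ≤ k → f (i + n + 1) < f i := by
      intro n
      induction n with
      | zero => exact fun hn => (cmp_eq_gt_iff _ _).1 (h i (by omega))
      | succ n ih =>
        exact fun hn => ((cmp_eq_gt_iff _ _).1 (h (i + n + 1) (by omega))).trans (ih (by omega))
    obtain ⟨n, rfl⟩ : ∃ n, j = i + n + 1 := ⟨j - i - 1, by omega⟩
    exact absurd hf (hlt n hj).ne'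
  | eq =>
    have h0 : ∀ a ≤ k, f a = f 0 := by
      intro a
      induction a with
      | zero => exact fun _ => rfl
      | succ a ih =>
        exact fun ha => ((cmp_eq_eq_iff _ _).1 (h a (by omega))).symm.trans (ih (by omega))
    exact fun a ha => (h0 a ha).trans (h0 i (by omega)).symm

/-- The reciprocal of the density of the independent sets found in the levels. -/
def levelConst (ℓ r D : ℕ) : ℕ :=
  (ℓ * r + 1) ^ (ℓ * r + 1) *
    (Fintype.card (Fin ℓ → Fin (ℓ * r + 1) × Finset (Fin (ℓ * r + 1))) *
      ((ℓ + D + 1) ^ Fintype.card (Fin (ℓ * r + 1) → Ordering) *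
        (2 * (Fintype.card (Fin (ℓ * r + 1) → Ordering) * ((ℓ + D) * r * D)) + 1)))

theorem levelConst_pos (ℓ r D : ℕ) : 0 < levelConst ℓ r D := by
  have : 0 < Fintype.card (Fin ℓ → Fin (ℓ * r + 1) × Finset (Fin (ℓ * r + 1))) :=
    Fintype.card_pos
  unfold levelConst
  positivity

/-- The closed neighbourhood of `S`. -/
def closedNbhd {α : Type*} [DecidableEq α] (B : Finset (Finset α)) (S : Finset α) : Finset α :=
  S ∪ (B.filter fun e => ∃ x ∈ e, x ∈ S).biUnion id

theorem closedNbhd_mono {α : Type*} [DecidableEq α] (B : Finset (Finset α))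
    {S T : Finset α} (h : S ⊆ T) : closedNbhd B S ⊆ closedNbhd B T := by
  refine Finset.union_subset_union h (Finset.biUnion_subset_biUnion_of_subset_left _ ?_)
  intro e he
  obtain ⟨h1, x, hx, hxS⟩ := Finset.mem_filter.1 he
  exact Finset.mem_filter.2 ⟨h1, x, hx, h hxS⟩

variable {α : Type*} [Fintype α]

open Classical in
/-- The vertices that are ends of linear paths of length `j` in `B` starting from `v`. -/
noncomputable def level (B : Finset (Finset α)) (v : α) (j : ℕ) : Finset α :=
  Finset.univ.filter fun x => ∃ E w, IsLinPath j E w ∧ (∀ i < j, E i ∈ B) ∧ w 0 = v ∧ w j = x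

theorem mem_level {B : Finset (Finset α)} {v x : α} {j : ℕ} : x ∈ level B v j ↔
    ∃ E w, IsLinPath j E w ∧ (∀ i < j, E i ∈ B) ∧ w 0 = v ∧ w j = x := by
  simp [level]

theorem level_zero (B : Finset (Finset α)) (v : α) : level B v 0 = {v} := by
  ext x
  rw [mem_level, Finset.mem_singleton]
  constructor
  · rintro ⟨E, w, -, -, h0, hx⟩
    exact hx.symm.trans h0
  · rintro rfl
    exact ⟨fun _ => ∅, fun _ => x, ⟨by simp, by simp, by simp, by simp⟩, by simp, rfl, rfl⟩

variable [LinearOrder α]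

/-- Choose a path from `v` to each vertex of the level. A colouring and pigeonhole leave a constant
fraction of ends whose paths are injectively coloured with the same pattern. Pairs of ends are typed
by comparing, colour by colour, the vertices of that colour on their paths. A long linear path of
one type would close to a forbidden cycle, so there is a dense independent set. -/
theorem exists_indep_subset_level {B : Finset (Finset α)} {D r ℓ : ℕ} (hD : PairDegreeLE B D)
    (hr : ∀ e ∈ B, e.card ≤ r) (h2 : ∀ e ∈ B, 2 ≤ e.card)
    (hcyc : ¬ ∃ C W, IsLinCycle ℓ C W ∧ ∀ i < ℓ, C i ∈ B) (v : α) {j : ℕ} (hj : 2 * j < ℓ) :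
    ∃ I ⊆ level B v j, Indep B I ∧ (level B v j).card ≤ levelConst ℓ r D * I.card := by
  classical
  rcases Nat.eq_zero_or_pos j with rfl | hjpos
  · rw [level_zero]
    refine ⟨{v}, subset_rfl, fun e he hsub => ?_, ?_⟩
    · have h3 := Finset.card_le_card hsub
      have h4 := h2 e he
      rw [Finset.card_singleton] at h3
      omega
    · simpa using Nat.succ_le_of_lt (levelConst_pos ℓ r D)
  set L := level B v j with hL
  rcases L.eq_empty_or_nonempty with hLe | hLne
  · refine ⟨∅, Finset.empty_subset _, fun e he hsub => ?_, by simp [hLe]⟩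
    have := h2 e he
    simp [Finset.subset_empty.1 hsub] at this
  have hch : ∀ x, ∃ q : (ℕ → Finset α) × (ℕ → α), x ∈ L → IsLinPath j q.1 q.2 ∧
      (∀ i < j, q.1 i ∈ B) ∧ q.2 0 = v ∧ q.2 j = x := by
    intro x
    by_cases hx : x ∈ L
    · obtain ⟨E, w, h⟩ := mem_level.1 hx
      exact ⟨(E, w), fun _ => h⟩
    · exact ⟨(fun _ => ∅, fun _ => x), fun h => absurd h hx⟩
  choose q hq using hch
  let E : α → ℕ → Finset α := fun x => (q x).1
  let w : α → ℕ → α := fun x => (q x).2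
  have hpath : ∀ x ∈ L, IsLinPath j (E x) (w x) := fun x hx => (hq x hx).1
  have hEB : ∀ x ∈ L, ∀ i < j, E x i ∈ B := fun x hx => (hq x hx).2.1
  have hw0 : ∀ x ∈ L, w x 0 = v := fun x hx => (hq x hx).2.2.1
  have hwj : ∀ x ∈ L, w x j = x := fun x hx => (hq x hx).2.2.2
  let P : α → Finset α := fun x => (Finset.range j).biUnion (E x)
  have hPmem : ∀ x, ∀ i < j, ∀ u ∈ E x i, u ∈ P x := fun x i hi u hu =>
    Finset.mem_biUnion.2 ⟨i, Finset.mem_range.2 hi, hu⟩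
  obtain ⟨χ, L₁, hL₁, hinj, hcard₁⟩ := exists_colouring_injOn (Nat.succ_pos (ℓ * r)) L P (by
    intro x hx
    refine (Finset.card_biUnion_le_card_mul _ _ r fun i hi =>
      hr _ (hEB x hx i (Finset.mem_range.1 hi))).trans ?_
    rw [Finset.card_range]
    exact (Nat.mul_le_mul_right r (by omega : j ≤ ℓ)).trans (Nat.le_succ _))
  have hL₁ne : L₁.Nonempty := by
    rw [Finset.nonempty_iff_ne_empty]
    rintro rfl
    have := hLne.card_pos
    simp only [Finset.card_empty, mul_zero] at hcard₁
    omega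
  obtain ⟨κ, hκ⟩ := exists_large_fiber L₁
    (fun x (i : Fin ℓ) => (χ (w x (i + 1)), (E x i).image χ)) hL₁ne
  set L₂ := L₁.filter fun x => (fun i : Fin ℓ => (χ (w x (i + 1)), (E x i).image χ)) = κ
    with hL₂
  have hL₂L : L₂ ⊆ L := (Finset.filter_subset _ _).trans hL₁
  have hinj₂ : ∀ x ∈ L₂, ∀ i < j, ∀ i' < j, ∀ u ∈ E x i, ∀ u' ∈ E x i', χ u = χ u' → u = u' :=
    fun x hx i hi i' hi' u hu u' hu' h => hinj x (Finset.mem_filter.1 hx).1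
      (hPmem x i hi u hu) (hPmem x i' hi' u' hu') h
  have hpat : ∀ x ∈ L₂, ∀ y ∈ L₂, ∀ i < j, χ (w x (i + 1)) = χ (w y (i + 1)) ∧
      (E x i).image χ = (E y i).image χ := by
    intro x hx y hy i hi
    have h := congrFun ((Finset.mem_filter.1 hx).2.trans (Finset.mem_filter.1 hy).2.symm)
      ⟨i, by omega⟩
    exact Prod.ext_iff.1 h
  -- The vertex of colour `c` on the path to `x`; the value for absent colours is irrelevant.
  let a : α → Fin (ℓ * r + 1) → α := fun x c =>
    if h : ∃ u ∈ P x, χ u = c then h.choose else x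
  have ha : ∀ x ∈ L₂, ∀ i < j, ∀ u ∈ E x i, a x (χ u) = u := by
    intro x hx i hi u hu
    have hex : ∃ u' ∈ P x, χ u' = χ u := ⟨u, hPmem x i hi u hu, rfl⟩
    simp only [a, dif_pos hex]
    exact hinj x (Finset.mem_filter.1 hx).1 hex.choose_spec.1 (hPmem x i hi u hu)
      hex.choose_spec.2
  rcases exists_indep_or_monochromatic_path hD hr h2
    (fun x y (c : Fin (ℓ * r + 1)) => cmp (a x c) (a y c)) (ℓ + D) L₂ with
    ⟨I, hI, hind, hcard₂⟩ | ⟨F, y, o, hF, hFo⟩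
  · refine ⟨I, hI.trans hL₂L, hind, ?_⟩
    calc L.card ≤ (ℓ * r + 1) ^ (ℓ * r + 1) * L₁.card := hcard₁
      _ ≤ (ℓ * r + 1) ^ (ℓ * r + 1) *
          (Fintype.card (Fin ℓ → Fin (ℓ * r + 1) × Finset (Fin (ℓ * r + 1))) * L₂.card) :=
        Nat.mul_le_mul_left _ hκ
      _ ≤ _ := Nat.mul_le_mul_left _ (Nat.mul_le_mul_left _ hcard₂)
      _ = _ := by simp only [levelConst, mul_assoc]
  · exfalso
    have hy : ∀ i ≤ ℓ + D, y i ∈ L₂ := by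
      intro i hi
      rcases hi.lt_or_eq with h | rfl
      · exact (hFo i h).2.1 (hF.left i h)
      · have h1 := hF.right (ℓ + D - 1) (by omega)
        rw [Nat.sub_add_cancel (by omega)] at h1
        exact (hFo (ℓ + D - 1) (by omega)).2.1 h1
    have hchain : ∀ c, ∀ i ≤ ℓ + D, ∀ i' ≤ ℓ + D, i ≠ i' → a (y i) c = a (y i') c →
        ∀ b ≤ ℓ + D, a (y b) c = a (y i) c := by
      intro c i hi i' hi' hne h b hb
      have hcmp : ∀ i < ℓ + D, cmp (a (y i) c) (a (y (i + 1)) c) = o c := fun i hi =>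
        congrFun (hFo i hi).2.2 c
      rcases lt_or_gt_of_ne hne with hlt | hlt
      · exact cmp_constant_chain (f := fun i => a (y i) c) hcmp hlt hi' h b hb
      · exact (cmp_constant_chain (f := fun i => a (y i) c) hcmp hlt hi h.symm b hb).trans h.symm
    refine hcyc (exists_linCycle_of_branches (G := fun i => E (y i)) (p := fun i => w (y i))
      (v := v) hD hjpos (Nat.le_add_left D ℓ) (Nat.le_add_right ℓ D) hj hF
      (fun i hi => (hFo i hi).1) (fun i hi => hpath _ (hL₂L (hy i hi)))
      (fun i hi => hEB _ (hL₂L (hy i hi))) (fun i hi => hw0 _ (hL₂L (hy i hi)))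
      (fun i hi => hwj _ (hL₂L (hy i hi))) ?_ ?_ ?_)
    -- A shared `u` is the vertex of its colour on both paths, hence on every path of the chain, and
    -- the common pattern puts it at position `l`.
    · intro i hi i' hi' hne l hl l' hl' u hu hu' b hb
      have h1 := ha _ (hy i hi) l hl u hu
      have h2 := ha _ (hy i' hi') l' hl' u hu'
      have h3 := hchain (χ u) i hi i' hi' hne (h1.trans h2.symm) b hb
      have h4 : χ u ∈ (E (y b) l).image χ := by
        rw [(hpat _ (hy b hb) _ (hy i hi) l hl).2]
        exact Finset.mem_image_of_mem χ hu
      obtain ⟨u', hu'b, hχ⟩ := Finset.mem_image.1 h4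
      have h5 := ha _ (hy b hb) l hl u' hu'b
      rw [hχ, h3, h1] at h5
      exact h5 ▸ hu'b
    · intro i hi i' hi' l hl hmem
      exact hinj₂ _ (hy i' hi') l hl l hl _ hmem _ ((hpath _ (hL₂L (hy i' hi'))).right l hl)
        (hpat _ (hy i hi) _ (hy i' hi') l hl).1
    -- `u` is itself an end, so it has the colour of the end `y i'`; both lie on one injectively
    -- coloured path.
    · intro i hi i' hi' l hl u hu hul
      have huL := (hFo i hi).2.1 hu
      have h1 := (hpat _ huL _ (hy i' hi') (j - 1) (by omega)).1
      rw [Nat.sub_add_cancel hjpos, hwj _ (hL₂L huL), hwj _ (hL₂L (hy i' hi'))] at h1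
      have h2 := (hpath _ (hL₂L (hy i' hi'))).right (j - 1) (by omega)
      rw [Nat.sub_add_cancel hjpos, hwj _ (hL₂L (hy i' hi'))] at h2
      exact hinj₂ _ (hy i' hi') l hl (j - 1) (by omega) u hul _ h2 h1

/-- A member through an end `p` that meets the path only in `p` prolongs it, so its other vertices
lie in the next level. Any other member also contains one of at most j * r path vertices, and each
of these accounts for at most D members of size at most r. -/
theorem card_closedNbhd_level_le {B : Finset (Finset α)} {D r : ℕ} (hD : PairDegreeLE B D)
    (hr : ∀ e ∈ B, e.card ≤ r) (v : α) (j : ℕ) :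
    (closedNbhd B (level B v j)).card ≤
      (level B v (j + 1)).card + (j * r * (D * r) + 1) * (level B v j).card := by
  classical
  have key : ∀ p ∈ level B v j, ∃ X : Finset α, X.card ≤ j * r * (D * r) + 1 ∧ p ∈ X ∧
      ∀ e ∈ B, p ∈ e → ∀ x ∈ e, x ∈ level B v (j + 1) ∨ x ∈ X := by
    intro p hp
    obtain ⟨E, w, hP, hEB, hw0, hwj⟩ := mem_level.1 hp
    let Y := (Finset.range j).biUnion E
    refine ⟨insert p ((Y.erase p).biUnion fun u =>
      (B.filter fun e => p ∈ e ∧ u ∈ e).biUnion id), ?_, Finset.mem_insert_self _ _, ?_⟩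
    · refine (Finset.card_insert_le _ _).trans (Nat.succ_le_succ ?_)
      refine (Finset.card_biUnion_le_card_mul _ _ (D * r) fun u hu => ?_).trans
        (Nat.mul_le_mul_right _ ?_)
      · refine (Finset.card_biUnion_le_card_mul _ _ r fun e he =>
          hr e (Finset.mem_filter.1 he).1).trans (Nat.mul_le_mul_right _ ?_)
        exact hD p u (Finset.ne_of_mem_erase hu).symm
      · refine (Finset.card_erase_le).trans ?_
        refine (Finset.card_biUnion_le_card_mul _ _ r fun i hi =>
          hr _ (hEB i (Finset.mem_range.1 hi))).trans ?_
        rw [Finset.card_range]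
    · intro e he hpe x hxe
      by_cases hxp : x = p
      · exact Or.inr (hxp ▸ Finset.mem_insert_self _ _)
      by_cases hdis : ∃ u ∈ Y.erase p, u ∈ e
      · obtain ⟨u, huY, hue⟩ := hdis
        refine Or.inr (Finset.mem_insert_of_mem (Finset.mem_biUnion.2 ⟨u, huY, ?_⟩))
        exact Finset.mem_biUnion.2 ⟨e, Finset.mem_filter.2 ⟨he, hpe, hue⟩, hxe⟩
      · left
        push Not at hdis
        have hmeet : ∀ i < j, ∀ u ∈ E i, u ∈ e → u = p := by
          intro i hi u hui hue
          by_contra hne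
          exact hdis u (Finset.mem_erase.2 ⟨hne, Finset.mem_biUnion.2
            ⟨i, Finset.mem_range.2 hi, hui⟩⟩) hue
        refine mem_level.2 ⟨Function.update E j e, Function.update w (j + 1) x,
          ⟨?_, ?_, ?_, ?_⟩, ?_, ?_, ?_⟩
        · intro i hi
          rw [Function.update_of_ne (show i ≠ j + 1 by omega)]
          rcases (Nat.lt_succ_iff.1 hi).lt_or_eq with h | rfl
          · rw [Function.update_of_ne (by omega)]; exact hP.left i h
          · rw [Function.update_self, hwj]; exact hpe
        · intro i hi
          rcases (Nat.lt_succ_iff.1 hi).lt_or_eq with h | rfl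
          · rw [Function.update_of_ne (by omega), Function.update_of_ne (by omega)]
            exact hP.right i h
          · rw [Function.update_self, Function.update_self]; exact hxe
        · intro i hi
          rw [Function.update_of_ne (show i ≠ j + 1 by omega)]
          rcases (Nat.lt_succ_iff.1 hi).lt_or_eq with h | rfl
          · rw [Function.update_of_ne (by omega)]; exact hP.ne i h
          · rw [Function.update_self, hwj]; exact Ne.symm hxp
        · intro i i' hii hi' u hu hu'
          rw [Function.update_of_ne (by omega)] at hu
          rcases (Nat.lt_succ_iff.1 hi').lt_or_eq with h | rfl
          · rw [Function.update_of_ne (by omega)] at hu'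
            rw [Function.update_of_ne (by omega)]
            exact hP.inter i i' hii h u hu hu'
          · rw [Function.update_self] at hu'
            rw [Function.update_of_ne (by omega), hwj]
            have hup := hmeet i hii u hu hu'
            refine ⟨?_, hup⟩
            have := hP.eq_or_of_mem le_rfl hii (by rw [hwj, ← hup]; exact hu)
            omega
        · intro i hi
          rcases (Nat.lt_succ_iff.1 hi).lt_or_eq with h | rfl
          · rw [Function.update_of_ne (by omega)]; exact hEB i h
          · rw [Function.update_self]; exact he
        · rw [Function.update_of_ne (by omega)]; exact hw0
        · rw [Function.update_self]
  choose! X hXcard hXp hX using key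
  have hsub : closedNbhd B (level B v j) ⊆
      level B v (j + 1) ∪ (level B v j).biUnion X := by
    intro x hx
    rcases Finset.mem_union.1 hx with hx | hx
    · exact Finset.mem_union_right _ (Finset.mem_biUnion.2 ⟨x, hx, hXp x hx⟩)
    · obtain ⟨e, he, hxe⟩ := Finset.mem_biUnion.1 hx
      obtain ⟨heB, p, hpe, hp⟩ := Finset.mem_filter.1 he
      rcases hX p hp e heB hpe x hxe with h | h
      · exact Finset.mem_union_left _ h
      · exact Finset.mem_union_right _ (Finset.mem_biUnion.2 ⟨p, hp, h⟩)
  refine (Finset.card_le_card hsub).trans ((Finset.card_union_le _ _).trans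
    (Nat.add_le_add_left ?_ _))
  rw [mul_comm]
  exact Finset.card_biUnion_le_card_mul _ _ _ hXcard

end Levels

/-! ### A slowly growing level and the greedy choice -/

section Growth

variable {α : Type*} [Fintype α] [LinearOrder α]

/-- The expansion constant: levels grow by a factor `g` whenever their closed neighbourhoods grow by
a factor `g + growthConst k r D`. -/
def growthConst (k r D : ℕ) : ℕ := k * r * (D * r) + 1

/-- Otherwise every level is at least g times the previous one, so level k has at least g ^ k
vertices and its dense independent subset has at least t. -/
theorem exists_level_card_closedNbhd_le {B : Finset (Finset α)} {D r ℓ k g t : ℕ}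
    (hD : PairDegreeLE B D) (hr : ∀ e ∈ B, e.card ≤ r) (h2 : ∀ e ∈ B, 2 ≤ e.card)
    (hcyc : ¬ ∃ C W, IsLinCycle ℓ C W ∧ ∀ i < ℓ, C i ∈ B) (hk : 2 * k < ℓ)
    (hg : levelConst ℓ r D * t ≤ g ^ k) (hg0 : 0 < g)
    (v : α) (hα : ∀ I ⊆ level B v k, Indep B I → I.card < t) :
    ∃ j ≤ k, (level B v j).Nonempty ∧ (closedNbhd B (level B v j)).card ≤
      (growthConst k r D + g) * (level B v j).card := by
  by_contra! hcon
  have hgrow : ∀ j ≤ k, g ^ j ≤ (level B v j).card := by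
    intro j
    induction j with
    | zero => exact fun _ => by simp [level_zero]
    | succ j ih =>
      intro hj
      have h1 := ih (by omega)
      have h3 := hcon j (by omega) (Finset.card_pos.1 ((pow_pos hg0 j).trans_le h1))
      have h4 := card_closedNbhd_level_le hD hr v j
      have h5 : (j * r * (D * r) + 1) * (level B v j).card ≤
          growthConst k r D * (level B v j).card := by
        unfold growthConst
        gcongr
        omega
      rw [add_mul] at h3
      calc g ^ (j + 1) = g * g ^ j := by ring
        _ ≤ g * (level B v j).card := Nat.mul_le_mul_left _ h1
        _ ≤ _ := by omega
  obtain ⟨I, hIL, hI, hcard⟩ := exists_indep_subset_level hD hr h2 hcyc v hk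
  have h1 := hgrow k le_rfl
  have h3 := Nat.mul_lt_mul_of_pos_left (hα I hIL hI) (levelConst_pos ℓ r D)
  omega

/-- Without a linear cycle of length `ℓ`, a family of bounded pair degree has an independent set of
density `1 / ((growthConst k r D + g) * levelConst ℓ r D)`. -/
theorem exists_large_indep {B : Finset (Finset α)} {D r ℓ k g t : ℕ}
    (hD : PairDegreeLE B D) (hr : ∀ e ∈ B, e.card ≤ r) (h2 : ∀ e ∈ B, 2 ≤ e.card)
    (hcyc : ¬ ∃ C W, IsLinCycle ℓ C W ∧ ∀ i < ℓ, C i ∈ B) (hk : 2 * k < ℓ)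
    (hg : levelConst ℓ r D * t ≤ g ^ k) (hg0 : 0 < g)
    (hα : ∀ I, Indep B I → I.card < t) (U : Finset α) :
    ∃ J ⊆ U, Indep B J ∧
      U.card ≤ (growthConst k r D + g) * levelConst ℓ r D * J.card := by
  induction U using Finset.strongInduction with
  | H U ih =>
    rcases U.eq_empty_or_nonempty with rfl | ⟨v, hv⟩
    · refine ⟨∅, subset_rfl, fun e he hsub => ?_, by simp⟩
      have := h2 e he
      simp [Finset.subset_empty.1 hsub] at this
    -- Levels are formed inside `U`, so that what is chosen and deleted stays in the remaining
    -- vertices.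
    set B' := B.filter (· ⊆ U) with hB'
    have hBB : B' ⊆ B := Finset.filter_subset _ _
    have hD' : PairDegreeLE B' D := fun x y hxy =>
      (Finset.card_le_card (Finset.filter_subset_filter _ hBB)).trans (hD x y hxy)
    have hcyc' : ¬ ∃ C W, IsLinCycle ℓ C W ∧ ∀ i < ℓ, C i ∈ B' := fun ⟨C, W, h, hC⟩ =>
      hcyc ⟨C, W, h, fun i hi => hBB (hC i hi)⟩
    have hlevel : ∀ j, level B' v j ⊆ U := by
      intro j x hx
      obtain ⟨E, w, hP, hE, h0, hj⟩ := mem_level.1 hx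
      rcases Nat.eq_zero_or_pos j with rfl | hpos
      · rwa [← hj, h0]
      · have h1 := hP.right (j - 1) (by omega)
        rw [Nat.sub_add_cancel hpos, hj] at h1
        exact (Finset.mem_filter.1 (hE (j - 1) (by omega))).2 h1
    have hind : ∀ I ⊆ U, Indep B' I → Indep B I := fun I hI h e he hsub =>
      h e (Finset.mem_filter.2 ⟨he, hsub.trans hI⟩) hsub
    obtain ⟨j, hj, hne, hnb⟩ := exists_level_card_closedNbhd_le hD'
      (fun e he => hr e (hBB he)) (fun e he => h2 e (hBB he)) hcyc' hk hg hg0 v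
      fun I hI h => hα I (hind I (hI.trans (hlevel k)) h)
    obtain ⟨I, hI, hIind, hIcard⟩ := exists_indep_subset_level hD'
      (fun e he => hr e (hBB he)) (fun e he => h2 e (hBB he)) hcyc' v (j := j) (by omega)
    have hInb : (closedNbhd B' I).card ≤
        (growthConst k r D + g) * levelConst ℓ r D * I.card := by
      refine (Finset.card_le_card (closedNbhd_mono B' hI)).trans (hnb.trans ?_)
      rw [mul_assoc]
      exact Nat.mul_le_mul_left _ hIcard
    have hIne : I.Nonempty := by
      rw [Finset.nonempty_iff_ne_empty]
      rintro rfl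
      have := hne.card_pos
      simp only [Finset.card_empty, mul_zero] at hIcard
      omega
    have hIN : I ⊆ closedNbhd B' I := Finset.subset_union_left
    obtain ⟨J, hJ, hJind, hJcard⟩ := ih (U \ closedNbhd B' I)
      ⟨Finset.sdiff_subset, fun h => by
        obtain ⟨x, hx⟩ := hIne
        exact (Finset.mem_sdiff.1 (h (hlevel j (hI hx)))).2 (hIN hx)⟩
    have hdisj : Disjoint I J := Finset.disjoint_left.2 fun x hx hxJ =>
      (Finset.mem_sdiff.1 (hJ hxJ)).2 (hIN hx)
    have hIJ : I ∪ J ⊆ U :=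
      Finset.union_subset (hI.trans (hlevel j)) (hJ.trans Finset.sdiff_subset)
    refine ⟨I ∪ J, hIJ, ?_, ?_⟩
    · intro e he hsub
      have heB' : e ∈ B' := Finset.mem_filter.2 ⟨he, hsub.trans hIJ⟩
      -- A member meeting `I` lies in the closed neighbourhood of `I`, which `J` avoids; hence it
      -- would lie in `I` alone.
      by_cases hmeet : ∃ x ∈ e, x ∈ I
      · refine hIind e heB' fun y hy => ?_
        rcases Finset.mem_union.1 (hsub hy) with h | h
        · exact h
        · refine absurd ?_ (Finset.mem_sdiff.1 (hJ h)).2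
          exact Finset.mem_union_right _
            (Finset.mem_biUnion.2 ⟨e, Finset.mem_filter.2 ⟨heB', hmeet⟩, hy⟩)
      · refine hJind e he fun y hy => ?_
        rcases Finset.mem_union.1 (hsub hy) with h | h
        · exact absurd ⟨y, hy, h⟩ hmeet
        · exact h
    · rw [Finset.card_union_of_disjoint hdisj, mul_add]
      have := Finset.card_le_card_sdiff_add_card (s := U) (t := closedNbhd B' I)
      omega

end Growth

/-! ### Back to colourings and Ramsey numbers -/

section Ramsey

/-- Each edge has r - 2 vertices besides its two meeting points, and these lie in no other edge, so
they can serve as its expansion vertices in any order. -/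
theorem IsLinCycle.containsCopy {β : Type*} {r ℓ : ℕ} (hr : 2 ≤ r) (hℓ : 4 ≤ ℓ)
    {G : Hypergraph β} {C : ℕ → Finset β} {W : ℕ → β} (h : IsLinCycle ℓ C W)
    (hC : ∀ i < ℓ, (C i : Set β) ∈ G.edgeSet) (hcard : ∀ i < ℓ, (C i).card = r)
    (hV : G.vertexSet = Set.univ) : ContainsCopy G (linearCycle r ℓ) := by
  classical
  have : NeZero ℓ := ⟨by omega⟩
  have : Fact (1 < ℓ) := ⟨by omega⟩
  have hlt : ∀ i : ZMod ℓ, i.val < ℓ := ZMod.val_lt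
  have hsucc : ∀ i : ZMod ℓ, (i.val + 1 < ℓ ∧ (i + 1).val = i.val + 1) ∨
      (i.val + 1 = ℓ ∧ (i + 1).val = 0) := by
    intro i
    have h1 := hlt i
    have h2 : (i + 1).val = (i.val + 1) % ℓ := by rw [ZMod.val_add, ZMod.val_one]
    rcases Nat.lt_or_ge (i.val + 1) ℓ with h3 | h3
    · exact Or.inl ⟨h3, by rw [h2, Nat.mod_eq_of_lt h3]⟩
    · have h4 : i.val + 1 = ℓ := by omega
      exact Or.inr ⟨h4, by rw [h2, h4, Nat.mod_self]⟩
  have hleft : ∀ i : ZMod ℓ, W i.val ∈ C i.val := fun i => h.left _ (hlt i)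
  have hright : ∀ i : ZMod ℓ, W (i + 1).val ∈ C i.val := by
    intro i
    rcases hsucc i with ⟨h1, h2⟩ | ⟨h1, h2⟩
    · rw [h2]; exact h.right _ h1
    · rw [h2, show i.val = ℓ - 1 by omega]; exact h.close
  have hWinj : ∀ i i' : ZMod ℓ, W i.val = W i'.val → i = i' := by
    intro i i' hW
    apply ZMod.val_injective
    rcases lt_trichotomy i.val i'.val with hlt' | heq | hlt'
    · exact absurd hW (h.vertex_ne hℓ hlt' (hlt i'))
    · exact heq
    · exact absurd hW.symm (h.vertex_ne hℓ hlt' (hlt i))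
  have hinter_lt : ∀ i i' : ZMod ℓ, i.val < i'.val → ∀ v ∈ C i.val, v ∈ C i'.val →
      (v = W i'.val ∧ i' = i + 1) ∨ (v = W i.val ∧ i = i' + 1) := by
    intro i i' hii v hv hv'
    rcases h.inter _ _ hii (hlt i') v hv hv' with ⟨h1, h2⟩ | ⟨h1, h2, h3⟩
    · refine Or.inl ⟨h2, ZMod.val_injective _ ?_⟩
      have := hlt i'
      rcases hsucc i with h4 | h4 <;> omega
    · refine Or.inr ⟨by rw [h1, h3], ZMod.val_injective _ ?_⟩
      rcases hsucc i' with h4 | h4 <;> omega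
  have hinter : ∀ i i' : ZMod ℓ, i ≠ i' → ∀ v ∈ C i.val, v ∈ C i'.val →
      (v = W i'.val ∧ i' = i + 1) ∨ (v = W i.val ∧ i = i' + 1) := by
    intro i i' hne v hv hv'
    rcases lt_trichotomy i.val i'.val with hlt' | heq | hlt'
    · exact hinter_lt i i' hlt' v hv hv'
    · exact absurd (ZMod.val_injective _ heq) hne
    · exact (hinter_lt i' i hlt' v hv' hv).symm
  let R : ZMod ℓ → Finset β := fun i => (C i.val).erase (W i.val) |>.erase (W (i + 1).val)
  have hR : ∀ i, (R i).card = r - 2 := by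
    intro i
    have h1 : W (i + 1).val ≠ W i.val := fun hW => by simpa using hWinj _ _ hW
    simp only [R]
    rw [Finset.card_erase_of_mem (Finset.mem_erase.2 ⟨h1, hright i⟩),
      Finset.card_erase_of_mem (hleft i), hcard _ (hlt i)]
    omega
  let g : ∀ i, Fin (r - 2) ≃ R i := fun i => ((R i).equivFinOfCardEq (hR i)).symm
  have hgmem : ∀ i q, (g i q : β) ∈ C i.val ∧ (g i q : β) ≠ W i.val ∧
      (g i q : β) ≠ W (i + 1).val := by
    intro i q
    have h1 := (g i q).2
    simp only [R, Finset.mem_erase] at h1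
    exact ⟨h1.2.2, h1.2.1, h1.1⟩
  have hmixed : ∀ (x i : ZMod ℓ) (q : Fin (r - 2)), W x.val ≠ (g i q : β) := by
    intro x i q hW
    obtain ⟨h1, h2, h3⟩ := hgmem i q
    by_cases hxi : i = x
    · subst hxi; exact h2 hW.symm
    · rcases hinter i x hxi _ h1 (hW ▸ hleft x) with ⟨-, rfl⟩ | ⟨h4, -⟩
      · exact h3 hW.symm
      · exact h2 h4
  let f : ZMod ℓ ⊕ ZMod ℓ × Fin (r - 2) → β :=
    Sum.elim (fun i => W i.val) fun p => g p.1 p.2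
  refine ⟨f, ?_, fun _ _ => hV ▸ Set.mem_univ _, ?_⟩
  · apply Function.Injective.injOn
    rintro (x | ⟨i, q⟩) (x' | ⟨i', q'⟩) hf <;> simp only [f, Sum.elim_inl, Sum.elim_inr] at hf
    · rw [hWinj _ _ hf]
    · exact absurd hf (hmixed _ _ _)
    · exact absurd hf.symm (hmixed _ _ _)
    · by_cases hii : i = i'
      · subst hii
        rw [(g i).injective (Subtype.ext hf)]
      · obtain ⟨h1, h2, -⟩ := hgmem i q
        obtain ⟨h4, h5, -⟩ := hgmem i' q'
        rcases hinter i i' hii _ h1 (hf ▸ h4) with ⟨h3, -⟩ | ⟨h3, -⟩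
        · exact absurd (hf ▸ h3) h5
        · exact absurd h3 h2
  · rintro _ ⟨i, rfl⟩
    have himg : f '' linearCycleEdge r ℓ i = (C i.val : Set β) := by
      ext u
      constructor
      · rintro ⟨(x | ⟨i', q⟩), hx, rfl⟩
        · rw [mem_linearCycleEdge_inl] at hx
          rcases hx with rfl | rfl
          · exact hleft _
          · exact hright _
        · rw [mem_linearCycleEdge_inr] at hx
          obtain rfl : i' = i := hx
          exact (hgmem _ _).1
      · intro hu
        by_cases h1 : u = W i.val
        · exact ⟨Sum.inl i, (mem_linearCycleEdge_inl _ _).2 (Or.inl rfl), h1.symm⟩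
        by_cases h2 : u = W (i + 1).val
        · exact ⟨Sum.inl (i + 1), (mem_linearCycleEdge_inl _ _).2 (Or.inr rfl), h2.symm⟩
        have hu' : u ∈ R i := Finset.mem_erase.2 ⟨h2, Finset.mem_erase.2 ⟨h1, hu⟩⟩
        refine ⟨Sum.inr (i, (g i).symm ⟨u, hu'⟩), (mem_linearCycleEdge_inr _ _).2 rfl, ?_⟩
        simp [f]
    rw [himg]
    exact hC _ (hlt i)

/-- The bound for the pair degrees of the family of minimal fat sets. -/
def pairDegreeBound (r ℓ : ℕ) : ℕ := ((ℓ * r + 1) * r) ^ r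

theorem arrows_linearCycle {r ℓ k g t n : ℕ} (hr : 2 ≤ r) (hℓ : 4 ≤ ℓ) (hk : 2 * k < ℓ)
    (hg0 : 0 < g) (hg : levelConst ℓ r (pairDegreeBound r ℓ) * t ≤ g ^ k)
    (hn : (growthConst k r (pairDegreeBound r ℓ) + g) *
      levelConst ℓ r (pairDegreeBound r ℓ) * t ≤ n) :
    Arrows r (linearCycle r ℓ) (completeUniform r t) n := by
  classical
  intro c
  by_contra! hcon
  obtain ⟨hred, hblue⟩ := hcon
  set D := pairDegreeBound r ℓ with hDdef
  let H : Finset (Finset (Fin n)) := Finset.univ.filter fun e =>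
    (e : Set (Fin n)) ∈ (colourClass c Colour.red).edgeSet
  have hmem : ∀ e, e ∈ H ↔ (e : Set (Fin n)) ∈ (colourClass c Colour.red).edgeSet := fun e => by
    simp [H]
  have hH : ∀ e ∈ H, e.card = r := by
    intro e he
    obtain ⟨h, -⟩ := (hmem e).1 he
    have h' : (e : Set (Fin n)).ncard = r := h
    rwa [Set.ncard_coe_finset] at h'
  -- One more than the number of vertices that ℓ sets of size at most r can cover.
  let K := ℓ * r + 1
  have hK : 0 < K := Nat.succ_pos _
  let B : Finset (Finset (Fin n)) := Finset.univ.filter (MinFat H K)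
  have hB : ∀ e ∈ B, MinFat H K e := fun e he => (Finset.mem_filter.1 he).2
  have hBD : PairDegreeLE B D := by
    intro x y hxy
    have h1 := card_minFat_superset_le hH hK (by omega) hB r {x, y}
      (Finset.card_pair hxy).ge (by omega)
    simp only [Finset.insert_subset_iff, Finset.singleton_subset_iff] at h1
    exact h1
  have hcyc : ¬ ∃ C W, IsLinCycle ℓ C W ∧ ∀ i < ℓ, C i ∈ B := by
    rintro ⟨C, W, h, hC⟩
    obtain ⟨E, hE, hEH⟩ := h.exists_edges_of_fat hH (Nat.lt_succ_self _)
      fun i hi => (hB _ (hC i hi)).2.1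
    exact hred (hE.containsCopy hr hℓ (fun i hi => (hmem _).1 (hEH i hi))
      (fun i hi => hH _ (hEH i hi)) rfl)
  have hα : ∀ I, Indep B I → I.card < t := by
    intro I hI
    by_contra! hle
    obtain ⟨I', hI', hcard⟩ := Finset.exists_subset_card_eq hle
    let φ := (I'.equivFinOfCardEq hcard).symm
    have hφ : Function.Injective fun a => (φ a : Fin n) :=
      Subtype.val_injective.comp φ.injective
    refine hblue ⟨fun a => φ a, hφ.injOn,
      fun _ _ => Set.mem_univ _, ?_⟩
    intro e he
    have he' : e.ncard = r := he
    have hcard' : ((fun a => (φ a : Fin n)) '' e).ncard = r := by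
      rw [Set.ncard_image_of_injective _ hφ, he']
    refine ⟨hcard', ?_⟩
    cases hcol : c ⟨(fun a => (φ a : Fin n)) '' e, hcard'⟩ with
    | blue => rfl
    | red =>
      exfalso
      let e₁ : Finset (Fin n) := (Set.toFinite ((fun a => (φ a : Fin n)) '' e)).toFinset
      have he₁ : e₁ ∈ H := (hmem _).2 (by
        rw [Set.Finite.coe_toFinset]
        exact ⟨hcard', hcol⟩)
      -- A red edge inside `I` would contain a minimal fat set, so all edges inside `I` are blue.
      obtain ⟨T, hT, hTf⟩ := exists_minFat_subset (by rw [hH _ he₁]; exact hr)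
        (Fat.edge (K := K) e₁ he₁)
      refine hI T (Finset.mem_filter.2 ⟨Finset.mem_univ _, hTf⟩) (hT.trans ?_)
      intro u hu
      rw [Set.Finite.mem_toFinset] at hu
      obtain ⟨a, -, rfl⟩ := hu
      exact hI' (φ a).2
  obtain ⟨J, -, hJ, hJcard⟩ := exists_large_indep hBD (fun e he => (hB e he).2.1.card_le hH hK)
    (fun e he => (hB e he).1) hcyc hk hg hg0 hα Finset.univ
  rw [Finset.card_univ, Fintype.card_fin] at hJcard
  have hpos : 0 < (growthConst k r D + g) * levelConst ℓ r D :=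
    Nat.mul_pos (by omega) (levelConst_pos _ _ _)
  have := Nat.mul_lt_mul_of_pos_left (hα J hJ) hpos
  omega

end Ramsey

end CycleComplete

theorem theorem7p13 (m r : ℕ) (hm : 2 ≤ m) (hr : 3 ≤ r) :
    ∃ b : ℝ, 0 < b ∧ ∀ t : ℕ, 1 ≤ t →
      ∃ R : ℕ,
        CycleComplete.IsRamseyNumber r (CycleComplete.linearCycle r (2 * m + 1))
          (CycleComplete.completeUniform r t) R ∧
        (R : ℝ) ≤ b * (t : ℝ) ^ ((m : ℝ) / ((m : ℝ) - 1)) := by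
  classical
  set D := CycleComplete.pairDegreeBound r (2 * m + 1) with hD
  set Q := CycleComplete.levelConst (2 * m + 1) r D with hQ
  set A := CycleComplete.growthConst (m - 1) r D with hA
  have hQpos : 0 < Q := CycleComplete.levelConst_pos _ _ _
  refine ⟨(A + 1 + Q) * Q, by positivity, fun t ht => ?_⟩
  have hm1 : (0 : ℝ) < (m : ℝ) - 1 := by
    have : (2 : ℝ) ≤ m := by exact_mod_cast hm
    linarith
  have hmcast : ((m - 1 : ℕ) : ℝ) = (m : ℝ) - 1 := by
    rw [Nat.cast_sub (by omega), Nat.cast_one]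
  have ht1 : (1 : ℝ) ≤ t := by exact_mod_cast ht
  have hQ1 : (1 : ℝ) ≤ Q := by exact_mod_cast hQpos
  -- With k = m - 1 levels, g is the least integer whose power g ^ (m - 1) is at least Q * t.
  set z : ℝ := (Q * t : ℝ) ^ (1 / ((m : ℝ) - 1)) with hz
  have hz0 : 0 < z := by positivity
  set g := ⌈z⌉₊ with hg
  have hg0 : 0 < g := Nat.ceil_pos.2 hz0
  have hgpow : Q * t ≤ g ^ (m - 1) := by
    have h1 : z ^ (m - 1) = Q * t := by
      rw [hz, ← Real.rpow_natCast, ← Real.rpow_mul (by positivity), hmcast,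
        one_div_mul_cancel hm1.ne', Real.rpow_one]
    have h2 : (Q * t : ℝ) ≤ (g : ℝ) ^ (m - 1) := by
      rw [← h1]
      exact pow_le_pow_left₀ hz0.le (Nat.le_ceil z) _
    exact_mod_cast h2
  have harrow := CycleComplete.arrows_linearCycle (r := r) (ℓ := 2 * m + 1) (k := m - 1) (g := g)
    (t := t) (by omega) (by omega) (by omega) hg0 hgpow le_rfl
  have hpos : 0 < (A + g) * Q * t := Nat.mul_pos (Nat.mul_pos (by omega) hQpos) ht
  have hex : ∃ n, 0 < n ∧ CycleComplete.Arrows r (CycleComplete.linearCycle r (2 * m + 1))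
      (CycleComplete.completeUniform r t) n := ⟨_, hpos, harrow⟩
  refine ⟨Nat.find hex, ⟨Nat.find_spec hex, fun n hn => Nat.find_min' hex hn⟩, ?_⟩
  have hle : (Nat.find hex : ℝ) ≤ ((A + g) * Q * t : ℕ) := by
    exact_mod_cast Nat.find_min' hex ⟨hpos, harrow⟩
  refine hle.trans ?_
  -- Since m ≥ 2 and Q ≥ 1, the root of Q is at most Q.
  have hzQ : z ≤ Q * (t : ℝ) ^ (1 / ((m : ℝ) - 1)) := by
    rw [hz, Real.mul_rpow (by positivity) (by positivity)]
    refine mul_le_mul_of_nonneg_right ?_ (by positivity)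
    refine (Real.rpow_le_rpow_of_exponent_le hQ1 ?_).trans_eq (Real.rpow_one _)
    rw [div_le_one hm1]
    have : (2 : ℝ) ≤ m := by exact_mod_cast hm
    linarith
  have hone : (1 : ℝ) ≤ (t : ℝ) ^ (1 / ((m : ℝ) - 1)) :=
    Real.one_le_rpow ht1 (by positivity)
  have hsum : (A + g : ℝ) ≤ (A + 1 + Q) * (t : ℝ) ^ (1 / ((m : ℝ) - 1)) := by
    have h1 : (g : ℝ) ≤ z + 1 := (Nat.ceil_lt_add_one hz0.le).le
    have h2 : (A + 1 : ℝ) ≤ (A + 1) * (t : ℝ) ^ (1 / ((m : ℝ) - 1)) :=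
      le_mul_of_one_le_right (by positivity) hone
    rw [add_mul]
    linarith
  have hexp : (t : ℝ) ^ ((m : ℝ) / ((m : ℝ) - 1)) = (t : ℝ) ^ (1 / ((m : ℝ) - 1)) * t := by
    rw [show (m : ℝ) / ((m : ℝ) - 1) = 1 / ((m : ℝ) - 1) + 1 by field_simp; ring,
      Real.rpow_add (by positivity), Real.rpow_one]
  rw [hexp]
  push_cast
  calc (A + g : ℝ) * Q * t
      ≤ ((A + 1 + Q) * (t : ℝ) ^ (1 / ((m : ℝ) - 1))) * Q * t := by gcongr
    _ = _ := by ring
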